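/- All graphs are finite, simple and undirected. For an integer $\ell\ge 1$, an \emph{$\ell$-page queue layout} of a graph $G$ is a pair $\langle\prec_G,\sigma_G\rangle$ of a linear order $\prec_G$ of $V(G)$ and a map $\sigma_G\colon E(G)\to\{1,\dots,\ell\}$ such that there are no two edges $u_1v_1,u_2v_2\in E(G)$ with $\sigma_G(u_1v_1)=\sigma_G(u_2v_2)$ and $u_1\prec_G u_2\prec_G v_2\prec_G v_1$. For a subgraph $H$ of $G$, it \emph{extends} an $\ell$-page queue layout $\langle\prec_H,\sigma_H\rangle$ of $H$ if $u\prec_H v\Leftrightarrow u\prec_G v$ for all $u,v\in V(H)$ and $\sigma_G(e)=\sigma_H(e)$ for all $e\in E(H)$. The problem \textsc{Queue Layout Extension} asks, given an integer $\ell\ge 1$, a graph $G$, a subgraph $H$ of $G$ and an $\ell$-page queue layout $\langle\prec_H,\sigma_H\rangle$ of $H$, whether there is an $\ell$-page queue layout of $G$ that extends $\langle\prec_H,\sigma_H\rangle$. Let $\kappa=|V(G)\setminus V(H)|+|E(G)\setminus E(H)|$ be the number of missing vertices and edges. \textbf{Theorem.} \textsc{Queue Layout Extension} is fixed-parameter tractable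 when parameterized by $\ell+\kappa$. That is, there are an algorithm, a computable function $f\colon\mathbb N\to\mathbb N$ and a constant $c$ such that, on every instance, the algorithm correctly decides the problem within $f(\ell+\kappa)\cdot\bigl(|V(G)|+|E(G)|+\ell\bigr)^{c}$ steps. (Algorithms are programs of a unit-cost random access machine over the natural numbers with addition and truncated subtraction, but without multiplication. An instance with $V(G)=\{0,\dots,n-1\}$ is given by $n$, $\ell$, the position of every vertex of $H$ in $\prec_H$, with the missing vertices marked, and the adjacency matrix of $G$, whose entries also tell the missing edges from the edges of $H$ and record the pages of the latter.) -/

import Mathlib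

/-! ### Random access machines with a step count -/

/-- Programs of a random access machine.  The machine has registers `0, 1, 2, …`, addressed directly,
and memories (arrays) `0, 1, 2, …`, whose cells are addressed through registers; every register and
every cell holds a natural number.  A program is a finite text, so it uses only finitely many
registers and finitely many memories.  The only arithmetic is addition and truncated subtraction
(no multiplication), so that unit cost is a polynomially realistic measure of time. -/
inductive RamProgram : Type
  /-- `R[i] := c` -/
  | const (i c : ℕ)
  /-- `R[i] := R[j]` -/
  | copy (i j : ℕ)
  /-- `R[i] := R[j] + R[k]` -/
  | add (i j k : ℕ)
  /-- `R[i] := R[j] - R[k]`, or `0` if `R[j] < R[k]` -/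
  | sub (i j k : ℕ)
  /-- `R[i] := A[R[j]]`, where `A` is the memory with number `a` -/
  | load (i a j : ℕ)
  /-- `A[R[i]] := R[j]`, where `A` is the memory with number `a` -/
  | store (a i j : ℕ)
  /-- run `p`, then `q` -/
  | seq (p q : RamProgram)
  /-- run `p` if `R[i] ≠ 0`, and `q` otherwise -/
  | ite (i : ℕ) (p q : RamProgram)
  /-- run `p` again and again as long as `R[i] ≠ 0` -/
  | loop (i : ℕ) (p : RamProgram)

/-- The contents of the registers and of the memories. -/
@[ext]
structure RamState where
  reg : ℕ → ℕ
  mem : ℕ → ℕ → ℕ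

namespace RamState

/-- Write `x` into register `i`. -/
def setReg (s : RamState) (i x : ℕ) : RamState :=
  { s with reg := Function.update s.reg i x }

/-- Write `x` into the cell with address `j` of memory `a`. -/
def setMem (s : RamState) (a j x : ℕ) : RamState :=
  { s with mem := Function.update s.mem a (Function.update (s.mem a) j x) }

/-- The initial state on an input word `w`: memory `0` holds `w`, register `0` holds the length of
`w`, and everything else is `0`. -/
def init (w : List ℕ) : RamState where
  reg i := if i = 0 then w.length else 0
  mem a j := if a = 0 then w.getD j 0 else 0

end RamState

/-- `RamProgram.Runs p s s' t`: started in state `s`, the program `p` halts in state `s'` after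
exactly `t` steps.  Every elementary instruction and every test of a register takes one step. -/
inductive RamProgram.Runs : RamProgram → RamState → RamState → ℕ → Prop
  | const (s : RamState) (i c : ℕ) : Runs (.const i c) s (s.setReg i c) 1
  | copy (s : RamState) (i j : ℕ) : Runs (.copy i j) s (s.setReg i (s.reg j)) 1
  | add (s : RamState) (i j k : ℕ) : Runs (.add i j k) s (s.setReg i (s.reg j + s.reg k)) 1
  | sub (s : RamState) (i j k : ℕ) : Runs (.sub i j k) s (s.setReg i (s.reg j - s.reg k)) 1
  | load (s : RamState) (i a j : ℕ) : Runs (.load i a j) s (s.setReg i (s.mem a (s.reg j))) 1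
  | store (s : RamState) (a i j : ℕ) : Runs (.store a i j) s (s.setMem a (s.reg i) (s.reg j)) 1
  | seq {p q : RamProgram} {s s' s'' : RamState} {t t' : ℕ} :
      Runs p s s' t → Runs q s' s'' t' → Runs (.seq p q) s s'' (t + t')
  | ite_pos {i : ℕ} {p q : RamProgram} {s s' : RamState} {t : ℕ} :
      s.reg i ≠ 0 → Runs p s s' t → Runs (.ite i p q) s s' (t + 1)
  | ite_neg {i : ℕ} {p q : RamProgram} {s s' : RamState} {t : ℕ} :
      s.reg i = 0 → Runs q s s' t → Runs (.ite i p q) s s' (t + 1)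
  | loop_done {i : ℕ} {p : RamProgram} {s : RamState} :
      s.reg i = 0 → Runs (.loop i p) s s 1
  | loop_step {i : ℕ} {p : RamProgram} {s s' s'' : RamState} {t t' : ℕ} :
      s.reg i ≠ 0 → Runs p s s' t → Runs (.loop i p) s' s'' t' →
        Runs (.loop i p) s s'' (t + t' + 1)

/-- The machine is deterministic: a program has at most one halting run from a given state. -/
theorem RamProgram.Runs.unique {p : RamProgram} {s s₁ s₂ : RamState} {t₁ t₂ : ℕ}
    (h₁ : p.Runs s s₁ t₁) (h₂ : p.Runs s s₂ t₂) : s₁ = s₂ ∧ t₁ = t₂ := by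
  induction h₁ generalizing s₂ t₂ with
  | const | copy | add | sub | load | store => cases h₂; exact ⟨rfl, rfl⟩
  | seq _ _ ih ih' =>
    cases h₂ with
    | seq a b =>
      obtain ⟨rfl, rfl⟩ := ih a
      obtain ⟨rfl, rfl⟩ := ih' b
      exact ⟨rfl, rfl⟩
  | ite_pos h _ ih =>
    cases h₂ with
    | ite_pos _ a => obtain ⟨rfl, rfl⟩ := ih a; exact ⟨rfl, rfl⟩
    | ite_neg h' _ => exact absurd h' h
  | ite_neg h _ ih =>
    cases h₂ with
    | ite_pos h' _ => exact absurd h h'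
    | ite_neg _ a => obtain ⟨rfl, rfl⟩ := ih a; exact ⟨rfl, rfl⟩
  | loop_done h =>
    cases h₂ with
    | loop_done _ => exact ⟨rfl, rfl⟩
    | loop_step h' _ _ => exact absurd h h'
  | loop_step h _ _ ih ih' =>
    cases h₂ with
    | loop_done h' => exact absurd h' h
    | loop_step _ a b =>
      obtain ⟨rfl, rfl⟩ := ih a
      obtain ⟨rfl, rfl⟩ := ih' b
      exact ⟨rfl, rfl⟩

/-- The decision problem `Q` on the instances `α`, which are given to the machine through `encode`,
is fixed-parameter tractable with respect to the parameter `param`: there are a single program, a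
computable function `f` and a constant `c` such that on every instance `I` the program halts within
`f (param I) * (size I) ^ c` steps, and leaves a nonzero number in register `0` if and only if `I`
is a yes-instance. -/
def FixedParameterTractable {α : Type*} (encode : α → List ℕ) (size param : α → ℕ)
    (Q : α → Prop) : Prop :=
  ∃ (p : RamProgram) (f : ℕ → ℕ) (c : ℕ), Computable f ∧
    ∀ I : α, ∃ (s : RamState) (t : ℕ), p.Runs (RamState.init (encode I)) s t ∧
      t ≤ f (param I) * size I ^ c ∧ (s.reg 0 ≠ 0 ↔ Q I)

/-! ### Queue layouts -/

/-- With respect to the order `prec`, the edge `u₁v₁` nests the edge `u₂v₂`, where `u₁` and `u₂` are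
the left endpoints: `u₁ ≺ u₂ ≺ v₂ ≺ v₁`. -/
def Nests {V : Type*} (prec : V → V → Prop) (u₁ v₁ u₂ v₂ : V) : Prop :=
  prec u₁ u₂ ∧ prec u₂ v₂ ∧ prec v₂ v₁

/-- An `ℓ`-page queue layout of a graph: a (strict) linear order of the vertices and an assignment of
the edges to `ℓ` pages such that no two edges on the same page are in a nesting relation. -/
structure QueueLayout {V : Type*} (G : SimpleGraph V) (ℓ : ℕ) where
  /-- the spine order -/
  prec : V → V → Prop
  /-- the page assignment -/
  page : G.edgeSet → Fin ℓ
  prec_strictTotalOrder : IsStrictTotalOrder V prec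
  not_nests : ∀ (u₁ v₁ u₂ v₂ : V) (h₁ : G.Adj u₁ v₁) (h₂ : G.Adj u₂ v₂),
    page ⟨s(u₁, v₁), h₁⟩ = page ⟨s(u₂, v₂), h₂⟩ → ¬ Nests prec u₁ v₁ u₂ v₂

/-- A queue layout of `G` extends a queue layout of a subgraph `H` of `G`: the spine orders agree on
the vertices of `H` and the page assignments agree on the edges of `H`. -/
def QueueLayout.Extends {V : Type*} {G : SimpleGraph V} {H : G.Subgraph} {ℓ : ℕ}
    (L : QueueLayout G ℓ) (K : QueueLayout H.coe ℓ) : Prop :=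
  (∀ u v : H.verts, K.prec u v ↔ L.prec u v) ∧
  ∀ (u v : H.verts) (h : H.coe.Adj u v),
    L.page ⟨s((u : V), (v : V)), H.adj_sub h⟩ = K.page ⟨s(u, v), h⟩

/-! ### The problem Queue Layout Extension -/

/-- An instance of Queue Layout Extension.  The vertices of `G` are named `0, …, n - 1`. -/
structure QLEInstance where
  /-- the number of pages -/
  ℓ : ℕ
  one_le_ℓ : 1 ≤ ℓ
  /-- the number of vertices of `G` -/
  n : ℕ
  G : SimpleGraph (Fin n)
  H : G.Subgraph
  /-- the given queue layout of `H` -/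
  layout : QueueLayout H.coe ℓ

namespace QLEInstance

/-- `I` is a yes-instance: the given layout of `H` extends to an `ℓ`-page queue layout of `G`. -/
def IsYes (I : QLEInstance) : Prop :=
  ∃ L : QueueLayout I.G I.ℓ, L.Extends I.layout

/-- The size `|V(G)| + |E(G)| + ℓ` of an instance. -/
noncomputable def size (I : QLEInstance) : ℕ :=
  I.n + I.G.edgeSet.ncard + I.ℓ

/-- The number `κ` of missing elements: vertices and edges of `G` that are not in `H`. -/
noncomputable def missing (I : QLEInstance) : ℕ :=
  (I.H.vertsᶜ).ncard + (I.G.edgeSet \ I.H.edgeSet).ncard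

open Classical in
/-- The code of a vertex: `0` for a vertex that is missing from `H`, and `r + 1` for the vertex of `H`
that has exactly `r` vertices of `H` to its left on the given spine. -/
noncomputable def vertexCode (I : QLEInstance) (v : Fin I.n) : ℕ :=
  if hv : v ∈ I.H.verts then {u : I.H.verts | I.layout.prec u ⟨v, hv⟩}.ncard + 1 else 0

open Classical in
/-- An entry of the adjacency matrix of `G`: `0` for a non-edge, `1` for an edge that is missing
from `H`, and `p + 2` for an edge of `H` on page `p` (the pages being numbered from `0`). -/
noncomputable def pairCode (I : QLEInstance) (u v : Fin I.n) : ℕ :=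
  if h : I.H.Adj u v then
    (I.layout.page ⟨s(⟨u, I.H.edge_vert h⟩, ⟨v, I.H.edge_vert h.symm⟩), h⟩ : ℕ) + 2
  else if I.G.Adj u v then 1 else 0

/-- The input word of an instance: the number of vertices, the number of pages, the list of the
vertex codes, and the adjacency matrix row by row. -/
noncomputable def encode (I : QLEInstance) : List ℕ :=
  [I.n, I.ℓ] ++ (List.finRange I.n).map I.vertexCode ++
    (List.finRange I.n).flatMap fun u => (List.finRange I.n).map fun v => I.pairCode u v

end QLEInstance

/-! Call a vertex special if it is missing or an end of a missing edge. The relative order of the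
special vertices and the pages of the missing edges are found by brute force: with `k = ℓ + κ` there
are at most `(5k)^(4k)` guesses (`slotCount_le`). What remains is to choose, for every missing
vertex, its position, that is, the number of old vertices to its left; missing vertices at the same
position are ordered by the guess.

For a fixed guess the remaining constraints are Horn implications. If a missing edge `vu` with `v`
left of `u` and an old edge `ab` share a page, then "`v` before `a` and `b` before `u`" is
forbidden; as `a` and `b` are fixed, this says that `u` far to the right forces `v` to the right.
The other direction of nesting and the guessed order have the same form. Hence raising only those
vertices whose position is too small, starting from the lowest positions, never overtakes a solution
(`TooSmall.lt`, `sweeps_le`). If a solution exists, the positions add up to at most `n * n`, so `n *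
n + 1` sweeps reach a stable state (`sweeps_not_tooSmall`). A final test checks all constraints, and
that no old vertex has been moved. Soundness is `isYes_of_not_rejects`, completeness is
`exists_guess_of_isYes`.

For the running time, the algorithm is written with bounded sums and counting loops. If all loop
bounds are at most `M`, the compiled program takes at most `(M + 2) ^ w` steps, where `w` depends on
the program alone (`RamCmd.runs_compile`). Here `M` can be a function of `k` times the square of the
size. -/

/-! ### A structured language on top of the random access machine -/

/-- Arithmetic expressions over the registers and memories, with bounded sums. -/
inductive RamExpr : Type
  | lit (c : ℕ)
  | var (i : ℕ)
  | add (a b : RamExpr)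
  | sub (a b : RamExpr)
  /-- the content of the cell with address `e` of the memory `a` -/
  | load (a : ℕ) (e : RamExpr)
  /-- `a` if `c ≠ 0`, and `b` otherwise -/
  | cond (c a b : RamExpr)
  /-- the sum of `e` over all values of the register `i` below `b` -/
  | sum (i : ℕ) (b e : RamExpr)

namespace RamExpr

/-- The value of an expression. -/
def eval : RamExpr → RamState → ℕ
  | lit c, _ => c
  | var i, s => s.reg i
  | add a b, s => a.eval s + b.eval s
  | sub a b, s => a.eval s - b.eval s
  | load a e, s => s.mem a (e.eval s)
  | cond c a b, s => if c.eval s ≠ 0 then a.eval s else b.eval s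
  | sum i b e, s => ∑ j ∈ Finset.range (b.eval s), e.eval (s.setReg i j)

/-- All registers that occur in the expression are below `t`. -/
def Below (t : ℕ) : RamExpr → Prop
  | lit _ => True
  | var i => i < t
  | add a b => a.Below t ∧ b.Below t
  | sub a b => a.Below t ∧ b.Below t
  | load _ e => e.Below t
  | cond c a b => c.Below t ∧ a.Below t ∧ b.Below t
  | sum i b e => i < t ∧ b.Below t ∧ e.Below t

/-- All sums met during the evaluation have at most `M` summands. -/
def LoopsLE (M : ℕ) : RamExpr → RamState → Prop
  | lit _, _ => True
  | var _, _ => True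
  | add a b, s => a.LoopsLE M s ∧ b.LoopsLE M s
  | sub a b, s => a.LoopsLE M s ∧ b.LoopsLE M s
  | load _ e, s => e.LoopsLE M s
  | cond c a b, s => c.LoopsLE M s ∧ a.LoopsLE M s ∧ b.LoopsLE M s
  | sum i b e, s => b.LoopsLE M s ∧ b.eval s ≤ M ∧ ∀ j < b.eval s, e.LoopsLE M (s.setReg i j)

/-- A program that writes the value of the expression into register `t` and keeps all registers
below `t`. -/
def compile : RamExpr → ℕ → RamProgram
  | lit c, t => .const t c
  | var i, t => .copy t i
  | add a b, t => .seq (a.compile t) (.seq (b.compile (t + 1)) (.add t t (t + 1)))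
  | sub a b, t => .seq (a.compile t) (.seq (b.compile (t + 1)) (.sub t t (t + 1)))
  | load a e, t => .seq (e.compile t) (.load t a t)
  | cond c a b, t => .seq (c.compile t) (.ite t (a.compile t) (b.compile t))
  | sum i b e, t =>
    .seq (b.compile t) <| .seq (.const (t + 1) 0) <| .seq (.copy (t + 2) i) <|
    .seq (.const i 0) <|
    .seq (.loop t <| .seq (e.compile (t + 3)) <| .seq (.add (t + 1) (t + 1) (t + 3)) <|
      .seq (.const (t + 3) 1) <| .seq (.add i i (t + 3)) (.sub t t (t + 3))) <|
    .seq (.copy i (t + 2)) (.copy t (t + 1))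

end RamExpr

/-- Two states agree on the registers below `t` and on all memories. -/
def RamState.AgreeBelow (t : ℕ) (s s' : RamState) : Prop :=
  (∀ r < t, s.reg r = s'.reg r) ∧ s.mem = s'.mem

namespace RamState

theorem reg_setReg (s : RamState) (i x j : ℕ) :
    (s.setReg i x).reg j = if j = i then x else s.reg j := by
  simp [setReg, Function.update_apply]

@[simp] theorem mem_setReg (s : RamState) (i x : ℕ) : (s.setReg i x).mem = s.mem := rfl

@[simp] theorem reg_setMem (s : RamState) (a j x : ℕ) : (s.setMem a j x).reg = s.reg := rfl

theorem mem_setMem (s : RamState) (a j x b k : ℕ) :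
    (s.setMem a j x).mem b k = if b = a ∧ k = j then x else s.mem b k := by
  by_cases h : b = a
  · subst h; simp [setMem, Function.update_apply]
  · simp [setMem, h]

theorem AgreeBelow.setReg {t : ℕ} {s s' : RamState} (h : AgreeBelow t s s') (i x : ℕ) :
    AgreeBelow t (s.setReg i x) (s'.setReg i x) :=
  ⟨fun r hr => by simp [reg_setReg, h.1 r hr], h.2⟩

end RamState

theorem RamExpr.Below.mono {t t' : ℕ} (h : t ≤ t') {e : RamExpr} : e.Below t → e.Below t' := by
  induction e <;> simp_all [Below] <;> omega

theorem RamExpr.eval_congr {t : ℕ} (e : RamExpr) (he : e.Below t) :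
    ∀ {s s' : RamState}, s.AgreeBelow t s' → e.eval s = e.eval s' := by
  induction e with
  | lit c => intros; rfl
  | var i => intro s s' h; exact h.1 i he
  | add a b iha ihb => intro s s' h; simp [eval, iha he.1 h, ihb he.2 h]
  | sub a b iha ihb => intro s s' h; simp [eval, iha he.1 h, ihb he.2 h]
  | load a e ih => intro s s' h; simp [eval, ih he h, h.2]
  | cond c a b ihc iha ihb =>
    intro s s' h; simp [eval, ihc he.1 h, iha he.2.1 h, ihb he.2.2 h]
  | sum i b e ihb ihe =>
    intro s s' h
    simp only [eval, ihb he.2.1 h]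
    exact Finset.sum_congr rfl fun j _ => ihe he.2.2 (h.setReg i j)

theorem RamExpr.LoopsLE.congr {t M : ℕ} (e : RamExpr) (he : e.Below t) :
    ∀ {s s' : RamState}, s.AgreeBelow t s' → e.LoopsLE M s → e.LoopsLE M s' := by
  induction e with
  | lit c => intros; trivial
  | var i => intros; trivial
  | add a b iha ihb => exact fun h l => ⟨iha he.1 h l.1, ihb he.2 h l.2⟩
  | sub a b iha ihb => exact fun h l => ⟨iha he.1 h l.1, ihb he.2 h l.2⟩
  | load a e ih => exact fun h l => ih he h l
  | cond c a b ihc iha ihb =>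
    exact fun h l => ⟨ihc he.1 h l.1, iha he.2.1 h l.2.1, ihb he.2.2 h l.2.2⟩
  | sum i b e ihb ihe =>
    intro s s' h l
    refine ⟨ihb he.2.1 h l.1, ?_, ?_⟩
    · rw [← b.eval_congr he.2.1 h]; exact l.2.1
    · rw [← b.eval_congr he.2.1 h]
      exact fun j hj => ihe he.2.2 (h.setReg i j) (l.2.2 j hj)

/-- A loop that counts the register `i` down. -/
theorem RamProgram.Runs.countdown {p : RamProgram} {i T : ℕ} (inv : ℕ → RamState → Prop)
    (hreg : ∀ k s, inv k s → s.reg i = k)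
    (hstep : ∀ k s, inv (k + 1) s → ∃ s' t, p.Runs s s' t ∧ t ≤ T ∧ inv k s') :
    ∀ k s, inv k s → ∃ s' t, (RamProgram.loop i p).Runs s s' t ∧ t ≤ k * (T + 1) + 1 ∧ inv 0 s' := by
  intro k
  induction k with
  | zero => exact fun s h => ⟨s, 1, .loop_done (hreg 0 s h), by omega, h⟩
  | succ k ih =>
    intro s h
    obtain ⟨s₁, t₁, r₁, b₁, h₁⟩ := hstep k s h
    obtain ⟨s₂, t₂, r₂, b₂, h₂⟩ := ih s₁ h₁
    refine ⟨s₂, _, .loop_step (by rw [hreg _ s h]; omega) r₁ r₂, ?_, h₂⟩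
    have : (k + 1) * (T + 1) = k * (T + 1) + (T + 1) := by ring
    omega

/-! ### Time bounds that compose, and the compilation of expressions -/

theorem one_le_add_two_pow (M w : ℕ) : 1 ≤ (M + 2) ^ w := Nat.one_le_pow _ _ (by omega)

/-- Since the base is at least 2, bounds of the form `(M + 2) ^ w` are closed under addition, and
the new exponent does not depend on `M`. -/
theorem add_two_pow_add_add_two_pow_le (M u v : ℕ) :
    (M + 2) ^ u + (M + 2) ^ v ≤ (M + 2) ^ (u + v + 1) := by
  have h1 : (M + 2) ^ u ≤ (M + 2) ^ (u + v) := Nat.pow_le_pow_right (by omega) (by omega)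
  have h2 : (M + 2) ^ v ≤ (M + 2) ^ (u + v) := Nat.pow_le_pow_right (by omega) (by omega)
  rw [pow_succ]; nlinarith [Nat.zero_le ((M + 2) ^ (u + v) * M)]

theorem add_two_pow_add_le (M u c : ℕ) : (M + 2) ^ u + c ≤ (M + 2) ^ (u + c) := by
  induction c with
  | zero => simp
  | succ c ih =>
    have := one_le_add_two_pow M (u + c)
    rw [← add_assoc u, pow_succ]; nlinarith

/-- The compiled expression computes the value, in time polynomial in the bound on the loops. -/
theorem RamExpr.runs_compile (e : RamExpr) : ∃ w, ∀ M t s, e.Below t → e.LoopsLE M s →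
    ∃ s' k, (e.compile t).Runs s s' k ∧ k ≤ (M + 2) ^ w ∧ s.AgreeBelow t s' ∧
      s'.reg t = e.eval s := by
  induction e with
  | lit c =>
    refine ⟨0, fun M t s _ _ => ⟨_, _, .const s t c, by simp, ⟨fun r hr => ?_, rfl⟩, ?_⟩⟩
    · simp [RamState.reg_setReg, hr.ne]
    · simp [RamState.reg_setReg, eval]
  | var i =>
    refine ⟨0, fun M t s _ _ => ⟨_, _, .copy s t i, by simp, ⟨fun r hr => ?_, rfl⟩, ?_⟩⟩
    · simp [RamState.reg_setReg, hr.ne]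
    · simp [RamState.reg_setReg, eval]
  | add a b iha ihb =>
    obtain ⟨w₁, h₁⟩ := iha
    obtain ⟨w₂, h₂⟩ := ihb
    refine ⟨w₁ + w₂ + 1 + 1, fun M t s he hl => ?_⟩
    obtain ⟨s₁, k₁, r₁, b₁, g₁, v₁⟩ := h₁ M t s he.1 hl.1
    obtain ⟨s₂, k₂, r₂, b₂, g₂, v₂⟩ := h₂ M (t + 1) s₁ (he.2.mono (by omega)) (hl.2.congr _ he.2 g₁)
    refine ⟨_, _, .seq r₁ (.seq r₂ (.add _ t t (t + 1))), ?_, ⟨fun r hr => ?_, ?_⟩, ?_⟩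
    · have := add_two_pow_add_add_two_pow_le M w₁ w₂
      have := add_two_pow_add_le M (w₁ + w₂ + 1) 1
      omega
    · simp [RamState.reg_setReg, hr.ne, g₁.1 r hr, g₂.1 r (by omega)]
    · simp [g₁.2, g₂.2]
    · simp [RamState.reg_setReg, eval, v₂, ← g₂.1 t (by omega), v₁, b.eval_congr he.2 g₁]
  | sub a b iha ihb =>
    obtain ⟨w₁, h₁⟩ := iha
    obtain ⟨w₂, h₂⟩ := ihb
    refine ⟨w₁ + w₂ + 1 + 1, fun M t s he hl => ?_⟩
    obtain ⟨s₁, k₁, r₁, b₁, g₁, v₁⟩ := h₁ M t s he.1 hl.1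
    obtain ⟨s₂, k₂, r₂, b₂, g₂, v₂⟩ := h₂ M (t + 1) s₁ (he.2.mono (by omega)) (hl.2.congr _ he.2 g₁)
    refine ⟨_, _, .seq r₁ (.seq r₂ (.sub _ t t (t + 1))), ?_, ⟨fun r hr => ?_, ?_⟩, ?_⟩
    · have := add_two_pow_add_add_two_pow_le M w₁ w₂
      have := add_two_pow_add_le M (w₁ + w₂ + 1) 1
      omega
    · simp [RamState.reg_setReg, hr.ne, g₁.1 r hr, g₂.1 r (by omega)]
    · simp [g₁.2, g₂.2]
    · simp [RamState.reg_setReg, eval, v₂, ← g₂.1 t (by omega), v₁, b.eval_congr he.2 g₁]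
  | load a e ih =>
    obtain ⟨w₁, h₁⟩ := ih
    refine ⟨w₁ + 1, fun M t s he hl => ?_⟩
    obtain ⟨s₁, k₁, r₁, b₁, g₁, v₁⟩ := h₁ M t s he hl
    refine ⟨_, _, .seq r₁ (.load _ t a t), ?_, ⟨fun r hr => ?_, g₁.2⟩, ?_⟩
    · have := add_two_pow_add_le M w₁ 1
      omega
    · simp [RamState.reg_setReg, hr.ne, g₁.1 r hr]
    · simp [RamState.reg_setReg, eval, v₁, g₁.2]
  | cond c a b ihc iha ihb =>
    obtain ⟨w₀, h₀⟩ := ihc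
    obtain ⟨w₁, h₁⟩ := iha
    obtain ⟨w₂, h₂⟩ := ihb
    refine ⟨w₀ + (w₁ + w₂ + 1) + 1 + 1, fun M t s he hl => ?_⟩
    have i₁ := add_two_pow_add_add_two_pow_le M w₁ w₂
    have i₂ := add_two_pow_add_add_two_pow_le M w₀ (w₁ + w₂ + 1)
    have i₃ := add_two_pow_add_le M (w₀ + (w₁ + w₂ + 1) + 1) 1
    obtain ⟨s₀, k₀, r₀, b₀, g₀, v₀⟩ := h₀ M t s he.1 hl.1
    by_cases hc : c.eval s = 0
    · obtain ⟨s₁, k₁, r₁, b₁, g₁, v₁⟩ := h₂ M t s₀ he.2.2 (hl.2.2.congr _ he.2.2 g₀)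
      refine ⟨_, _, .seq r₀ (.ite_neg (by rw [v₀, hc]) r₁), by omega,
        ⟨fun r hr => (g₀.1 r hr).trans (g₁.1 r hr), g₀.2.trans g₁.2⟩, ?_⟩
      simp [eval, hc, v₁, b.eval_congr he.2.2 g₀]
    · obtain ⟨s₁, k₁, r₁, b₁, g₁, v₁⟩ := h₁ M t s₀ he.2.1 (hl.2.1.congr _ he.2.1 g₀)
      refine ⟨_, _, .seq r₀ (.ite_pos (by rwa [v₀]) r₁), by omega,
        ⟨fun r hr => (g₀.1 r hr).trans (g₁.1 r hr), g₀.2.trans g₁.2⟩, ?_⟩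
      simp [eval, hc, v₁, a.eval_congr he.2.1 g₀]
  | sum i b e ihb ihe =>
    obtain ⟨w₁, h₁⟩ := ihb
    obtain ⟨w₂, h₂⟩ := ihe
    refine ⟨w₁ + (w₂ + 5 + 1) + 1 + 6, fun M t s he hl => ?_⟩
    obtain ⟨hi, heb, hee⟩ := he
    obtain ⟨s₁, k₁, r₁, b₁, g₁, v₁⟩ := h₁ M t s heb hl.1
    set N := b.eval s with hN
    -- `k` is the number of rounds still to come, so the summation index is `N - k`. Register `t`
    -- counts down, `t + 1` accumulates, and `t + 2` saves the old content of `i`, which is restored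
    -- at the end so that the evaluation has no side effect below `t`.
    let inv : ℕ → RamState → Prop := fun k s' => k ≤ N ∧ s'.reg t = k ∧
      s'.reg (t + 1) = ∑ j ∈ Finset.range (N - k), e.eval (s.setReg i j) ∧
      s'.reg (t + 2) = s.reg i ∧ (s.setReg i (N - k)).AgreeBelow t s'
    have hloop := RamProgram.Runs.countdown (T := (M + 2) ^ w₂ + 4) (i := t)
      (p := .seq (e.compile (t + 3)) <| .seq (.add (t + 1) (t + 1) (t + 3)) <|
      .seq (.const (t + 3) 1) <| .seq (.add i i (t + 3)) (.sub t t (t + 3))) inv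
      (fun k s' h => h.2.1) ?_ N
      ((((s₁.setReg (t + 1) 0).setReg (t + 2) (s₁.reg i))).setReg i 0) ?_
    · obtain ⟨s₂, k₂, r₂, b₂, q₁, q₂, q₃, q₄, q₅⟩ := hloop
      refine ⟨_, _, .seq r₁ <| .seq (.const _ _ _) <| .seq (.copy _ _ _) <|
        .seq (.const _ _ _) <| .seq (s' := s₂) (t := k₂) ?_ <| .seq (.copy _ _ _) (.copy _ _ _), ?_,
        ⟨fun r hr => ?_, ?_⟩, ?_⟩
      · convert r₂ using 2
        simp [RamState.reg_setReg, (show i ≠ t + 1 by omega)]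
      · have h2 : N ≤ M := hl.2.1
        -- A round costs the evaluation, four instructions and the loop test, at most `(M + 2) ^ (w₂
        -- + 5)` in all; the at most `M` rounds and the final test cost one more factor `M + 2`.
        have h3 : N * ((M + 2) ^ w₂ + 4 + 1) + 1 ≤ (M + 2) ^ (w₂ + 5 + 1) := by
          have a1 := add_two_pow_add_le M w₂ 5
          have a2 := one_le_add_two_pow M (w₂ + 5)
          rw [pow_succ]
          nlinarith [Nat.mul_le_mul h2 a1]
        have h4 := add_two_pow_add_add_two_pow_le M w₁ (w₂ + 5 + 1)
        have h5 := add_two_pow_add_le M (w₁ + (w₂ + 5 + 1) + 1) 6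
        omega
      · have := q₅.1 r hr
        by_cases hri : r = i
        · subst hri; simp [RamState.reg_setReg, hr.ne, q₄]
        · simpa [RamState.reg_setReg, hr.ne, hri] using this
      · simpa using q₅.2
      · simp [RamState.reg_setReg, (show t + 1 ≠ i by omega), q₃, eval, hN]
    · rintro k s' ⟨q₁, q₂, q₃, q₄, q₅⟩
      have hlt : N - (k + 1) < N := by omega
      obtain ⟨s₂, k₂, r₂, b₂, g₂, v₂⟩ := h₂ M (t + 3) s' (hee.mono (by omega))
        ((hl.2.2 _ hlt).congr _ hee q₅)
      refine ⟨_, _, .seq r₂ <| .seq (.add _ _ _ _) <| .seq (.const _ _ _) <|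
        .seq (.add _ _ _ _) (.sub _ _ _ _), by omega, by omega, ?_, ?_, ?_, ⟨fun r hr => ?_, ?_⟩⟩
      · simp [RamState.reg_setReg, (show t ≠ i by omega), (show t + 3 ≠ i by omega),
          ← g₂.1 t (by omega), q₂]
      · simp only [RamState.reg_setReg, (show t + 1 ≠ i by omega), (show t + 1 ≠ t by omega),
          (show t + 1 ≠ t + 3 by omega), if_true, if_false]
        rw [show N - k = N - (k + 1) + 1 by omega, Finset.sum_range_succ, v₂,
          ← g₂.1 (t + 1) (by omega), q₃, e.eval_congr hee q₅]
      · simp [RamState.reg_setReg, (show t + 2 ≠ i by omega), ← g₂.1 (t + 2) (by omega), q₄]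
      · have := q₅.1 r hr
        by_cases hri : r = i
        · subst hri
          simp only [RamState.reg_setReg] at this ⊢
          simp [hr.ne, (show r ≠ t + 1 by omega), (show r ≠ t + 3 by omega),
            ← g₂.1 r (by omega), ← this]
          omega
        · simp only [RamState.reg_setReg] at this ⊢
          simpa [hr.ne, hri, (show r ≠ t + 1 by omega), (show r ≠ t + 3 by omega),
            ← g₂.1 r (by omega)] using this
      · simpa [← g₂.2] using q₅.2
    · refine ⟨le_rfl, ?_, ?_, ?_, ⟨fun r hr => ?_, ?_⟩⟩
      · simp [RamState.reg_setReg, (show t ≠ i by omega), v₁]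
      · simp [RamState.reg_setReg, (show t + 1 ≠ i by omega)]
      · simp [RamState.reg_setReg, (show t + 2 ≠ i by omega), g₁.1 i hi]
      · simp [RamState.reg_setReg, (show r ≠ t + 1 by omega), (show r ≠ t + 2 by omega),
          g₁.1 r hr]
      · simpa using g₁.2

/-! ### Loop programs and their compilation -/

/-- Commands: assignments and loops whose number of rounds is known in advance. -/
inductive RamCmd : Type
  /-- write the value of `e` into register `i` -/
  | assign (i : ℕ) (e : RamExpr)
  /-- write the value of `e` into the cell with address `j` of memory `a` -/
  | store (a : ℕ) (j e : RamExpr)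
  | seq (c d : RamCmd)
  /-- run `c` for all values of the register `i` below `b` -/
  | forLoop (i : ℕ) (b : RamExpr) (c : RamCmd)

namespace RamCmd

/-- The state after a command. -/
def run : RamCmd → RamState → RamState
  | assign i e, s => s.setReg i (e.eval s)
  | store a j e, s => s.setMem a (j.eval s) (e.eval s)
  | seq c d, s => d.run (c.run s)
  | forLoop i b c, s => Nat.rec s (fun k s' => c.run (s'.setReg i k)) (b.eval s)

/-- The state after `k` rounds of a loop. -/
def rounds (i : ℕ) (c : RamCmd) (s : RamState) (k : ℕ) : RamState :=
  Nat.rec s (fun k s' => c.run (s'.setReg i k)) k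

/-- All registers that occur in the command are below `t`. -/
def Below (t : ℕ) : RamCmd → Prop
  | assign i e => i < t ∧ e.Below t
  | store _ j e => j.Below t ∧ e.Below t
  | seq c d => c.Below t ∧ d.Below t
  | forLoop i b c => i < t ∧ b.Below t ∧ c.Below t

/-- All sums and loops met during the run have at most `M` rounds. -/
def LoopsLE (M : ℕ) : RamCmd → RamState → Prop
  | assign _ e, s => e.LoopsLE M s
  | store _ j e, s => j.LoopsLE M s ∧ e.LoopsLE M s
  | seq c d, s => c.LoopsLE M s ∧ d.LoopsLE M (c.run s)
  | forLoop i b c, s => b.LoopsLE M s ∧ b.eval s ≤ M ∧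
      ∀ k < b.eval s, c.LoopsLE M ((c.rounds i s k).setReg i k)

/-- A program that runs the command and keeps all registers below `t` otherwise. -/
def compile : RamCmd → ℕ → RamProgram
  | assign i e, t => .seq (e.compile t) (.copy i t)
  | store a j e, t => .seq (j.compile t) (.seq (e.compile (t + 1)) (.store a t (t + 1)))
  | seq c d, t => .seq (c.compile t) (d.compile t)
  | forLoop i b c, t =>
    .seq (b.compile t) <| .seq (.const (t + 1) 0) <|
    .loop t <| .seq (.copy i (t + 1)) <| .seq (c.compile (t + 2)) <| .seq (.const (t + 2) 1) <|
      .seq (.add (t + 1) (t + 1) (t + 2)) (.sub t t (t + 2))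

theorem rounds_zero (i : ℕ) (c : RamCmd) (s : RamState) : c.rounds i s 0 = s := rfl

theorem rounds_succ (i : ℕ) (c : RamCmd) (s : RamState) (k : ℕ) :
    c.rounds i s (k + 1) = c.run ((c.rounds i s k).setReg i k) := rfl

theorem run_forLoop (i : ℕ) (b : RamExpr) (c : RamCmd) (s : RamState) :
    (forLoop i b c).run s = c.rounds i s (b.eval s) := rfl

end RamCmd

theorem RamState.AgreeBelow.mono {t t' : ℕ} (h : t ≤ t') {s s' : RamState}
    (hs : s.AgreeBelow t' s') : s.AgreeBelow t s' := ⟨fun r hr => hs.1 r (by omega), hs.2⟩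

theorem RamState.AgreeBelow.trans {t : ℕ} {s s' s'' : RamState} (h : s.AgreeBelow t s')
    (h' : s'.AgreeBelow t s'') : s.AgreeBelow t s'' :=
  ⟨fun r hr => (h.1 r hr).trans (h'.1 r hr), h.2.trans h'.2⟩

/-- The exponent is chosen before `M`, so it depends on the command only. The scratch registers
start at `u`, possibly above `t`, because a loop body is compiled above the counters of the loop;
the last clause says that the body leaves these counters alone. The real state `s₀` need agree with
the ideal state `s` only below `t`, as scratch contents differ. -/
theorem RamCmd.runs_compile (c : RamCmd) : ∃ w, ∀ M t s, c.Below t → c.LoopsLE M s →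
    ∀ s₀ u, t ≤ u → s.AgreeBelow t s₀ → ∃ s' k, (c.compile u).Runs s₀ s' k ∧ k ≤ (M + 2) ^ w ∧
      (c.run s).AgreeBelow t s' ∧ ∀ r, t ≤ r → r < u → s'.reg r = s₀.reg r := by
  induction c with
  | assign i e =>
    obtain ⟨w, h⟩ := e.runs_compile
    refine ⟨w + 1, fun M t s hb hl s₀ u hu hs => ?_⟩
    obtain ⟨s₁, k₁, r₁, b₁, g₁, v₁⟩ := h M u s₀ (hb.2.mono hu) (hl.congr _ hb.2 hs)
    refine ⟨_, _, .seq r₁ (.copy _ _ _), ?_, ⟨fun r hr => ?_, ?_⟩, fun r hr hr' => ?_⟩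
    · have := add_two_pow_add_le M w 1
      omega
    · simp [run, RamState.reg_setReg, v₁, e.eval_congr hb.2 hs, hs.1 r hr, g₁.1 r (by omega)]
    · simpa [run, ← g₁.2] using hs.2
    · simp [RamState.reg_setReg, (show r ≠ i by have := hb.1; omega), g₁.1 r hr']
  | store a j e =>
    obtain ⟨w₁, h₁⟩ := j.runs_compile
    obtain ⟨w₂, h₂⟩ := e.runs_compile
    refine ⟨w₁ + w₂ + 1 + 1, fun M t s hb hl s₀ u hu hs => ?_⟩
    obtain ⟨s₁, k₁, r₁, b₁, g₁, v₁⟩ := h₁ M u s₀ (hb.1.mono hu) (hl.1.congr _ hb.1 hs)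
    have hs₁ := hs.trans (g₁.mono hu)
    obtain ⟨s₂, k₂, r₂, b₂, g₂, v₂⟩ := h₂ M (u + 1) s₁ (hb.2.mono (by omega))
      (hl.2.congr _ hb.2 hs₁)
    refine ⟨_, _, .seq r₁ (.seq r₂ (.store _ _ _ _)), ?_, ⟨fun r hr => ?_, ?_⟩, fun r hr hr' => ?_⟩
    · have := add_two_pow_add_add_two_pow_le M w₁ w₂
      have := add_two_pow_add_le M (w₁ + w₂ + 1) 1
      omega
    · simp [run, hs₁.1 r hr, g₂.1 r (by omega)]
    · simp only [run, RamState.setMem, v₂, ← g₂.1 u (by omega), v₁, ← g₂.2, hs₁.2,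
        j.eval_congr hb.1 hs, e.eval_congr hb.2 hs₁]
    · simp [g₁.1 r hr', g₂.1 r (by omega)]
  | seq c d ihc ihd =>
    obtain ⟨w₁, h₁⟩ := ihc
    obtain ⟨w₂, h₂⟩ := ihd
    refine ⟨w₁ + w₂ + 1, fun M t s hb hl s₀ u hu hs => ?_⟩
    obtain ⟨s₁, k₁, r₁, b₁, g₁, v₁⟩ := h₁ M t s hb.1 hl.1 s₀ u hu hs
    obtain ⟨s₂, k₂, r₂, b₂, g₂, v₂⟩ := h₂ M t _ hb.2 hl.2 s₁ u hu g₁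
    refine ⟨_, _, .seq r₁ r₂, ?_, g₂, fun r hr hr' => (v₂ r hr hr').trans (v₁ r hr hr')⟩
    have := add_two_pow_add_add_two_pow_le M w₁ w₂
    omega
  | forLoop i b c ih =>
    obtain ⟨w₁, h₁⟩ := b.runs_compile
    obtain ⟨w₂, h₂⟩ := ih
    refine ⟨w₁ + (w₂ + 5 + 1) + 1 + 1, fun M t s hb hl s₀ u hu hs => ?_⟩
    obtain ⟨hi, hbb, hbc⟩ := hb
    obtain ⟨s₁, k₁, r₁, b₁, g₁, v₁⟩ := h₁ M u s₀ (hbb.mono hu) (hl.1.congr _ hbb hs)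
    set N := b.eval s with hN
    -- Register `u` holds the number of rounds to come and `u + 1` the index of the current round,
    -- which is copied into `i` each time, so the body may overwrite `i`.
    let inv : ℕ → RamState → Prop := fun k s' => k ≤ N ∧ s'.reg u = k ∧ s'.reg (u + 1) = N - k ∧
      (c.rounds i s (N - k)).AgreeBelow t s' ∧ ∀ r, t ≤ r → r < u → s'.reg r = s₀.reg r
    have hloop := RamProgram.Runs.countdown (T := (M + 2) ^ w₂ + 4) (i := u)
      (p := .seq (.copy i (u + 1)) <| .seq (c.compile (u + 2)) <| .seq (.const (u + 2) 1) <|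
      .seq (.add (u + 1) (u + 1) (u + 2)) (.sub u u (u + 2))) inv
      (fun k s' h => h.2.1) ?_ N (s₁.setReg (u + 1) 0) ?_
    · obtain ⟨s₂, k₂, r₂, b₂, -, -, -, q₄, q₅⟩ := hloop
      refine ⟨_, _, .seq r₁ <| .seq (.const _ _ _) r₂, ?_, q₄, q₅⟩
      have h2 : N ≤ M := hl.2.1
      have h3 : N * ((M + 2) ^ w₂ + 4 + 1) + 1 ≤ (M + 2) ^ (w₂ + 5 + 1) := by
        have a1 := add_two_pow_add_le M w₂ 5
        have a2 := one_le_add_two_pow M (w₂ + 5)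
        rw [pow_succ]
        nlinarith [Nat.mul_le_mul h2 a1]
      have h4 := add_two_pow_add_add_two_pow_le M w₁ (w₂ + 5 + 1)
      have h5 := add_two_pow_add_le M (w₁ + (w₂ + 5 + 1) + 1) 1
      omega
    · rintro k s' ⟨q₁, q₂, q₃, q₄, q₅⟩
      have hlt : N - (k + 1) < N := by omega
      obtain ⟨s₂, k₂, r₂, b₂, g₂, v₂⟩ := h₂ M t _ hbc (hl.2.2 _ hlt) _ (u + 2) (by omega)
        (q₄.setReg i (N - (k + 1)))
      rw [show N - (k + 1) = s'.reg (u + 1) by omega] at r₂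
      have e₁ : s₂.reg (u + 1) = N - (k + 1) := by
        rw [v₂ _ (by omega) (by omega)]
        simp [RamState.reg_setReg, q₃, (show u + 1 ≠ i by omega)]
      have e₂ : s₂.reg u = k + 1 := by
        rw [v₂ _ (by omega) (by omega)]
        simp [RamState.reg_setReg, q₂, (show u ≠ i by omega)]
      refine ⟨_, _, .seq (.copy _ _ _) <| .seq r₂ <| .seq (.const _ _ _) <|
        .seq (.add _ _ _ _) (.sub _ _ _ _), by omega, by omega, ?_, ?_, ⟨fun r hr => ?_, ?_⟩,
        fun r hr hr' => ?_⟩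
      · simp [RamState.reg_setReg, e₂]
      · simp [RamState.reg_setReg, e₁]
        omega
      · rw [show N - k = N - (k + 1) + 1 by omega, RamCmd.rounds_succ, g₂.1 r hr]
        simp [RamState.reg_setReg, (show r ≠ u by omega), (show r ≠ u + 1 by omega),
          (show r ≠ u + 2 by omega)]
      · rw [show N - k = N - (k + 1) + 1 by omega, RamCmd.rounds_succ, g₂.2]
        simp
      · rw [← q₅ r hr hr']
        simp [RamState.reg_setReg, (show r ≠ u by omega), (show r ≠ u + 1 by omega),
          (show r ≠ u + 2 by omega), v₂ r hr (by omega), (show r ≠ i by omega)]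
    · refine ⟨le_rfl, ?_, ?_, ⟨fun r hr => ?_, ?_⟩, fun r hr hr' => ?_⟩
      · simp [RamState.reg_setReg, v₁, b.eval_congr hbb hs, hN]
      · simp [RamState.reg_setReg]
      · simp [RamState.reg_setReg, rounds_zero, (show r ≠ u + 1 by omega), hs.1 r hr,
          g₁.1 r (by omega)]
      · simpa [rounds_zero, ← g₁.2] using hs.2
      · simp [RamState.reg_setReg, (show r ≠ u + 1 by omega), g₁.1 r hr']

/-! ### Expressions as formulas with bounded quantifiers -/

namespace RamExpr

/-- All sums run over the values below some register. -/
def VarBounded : RamExpr → Prop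
  | lit _ => True
  | var _ => True
  | add a b => a.VarBounded ∧ b.VarBounded
  | sub a b => a.VarBounded ∧ b.VarBounded
  | load _ e => e.VarBounded
  | cond c a b => c.VarBounded ∧ a.VarBounded ∧ b.VarBounded
  | sum _ b e => (∃ i, b = var i) ∧ e.VarBounded

/-- Only registers bound sums, and a summation index stays below such a register, so the bound on
the registers survives inside the sum. Memory contents may be arbitrarily large. -/
theorem VarBounded.loopsLE {M t : ℕ} {e : RamExpr} (h : e.VarBounded) (he : e.Below t) :
    ∀ {s : RamState}, (∀ r < t, s.reg r ≤ M) → e.LoopsLE M s := by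
  induction e with
  | lit c => intros; trivial
  | var i => intros; trivial
  | add a b iha ihb => exact fun l => ⟨iha h.1 he.1 l, ihb h.2 he.2 l⟩
  | sub a b iha ihb => exact fun l => ⟨iha h.1 he.1 l, ihb h.2 he.2 l⟩
  | load a e ih => exact fun l => ih h he l
  | cond c a b ihc iha ihb =>
    exact fun l => ⟨ihc h.1 he.1 l, iha h.2.1 he.2.1 l, ihb h.2.2 he.2.2 l⟩
  | sum i b e ihb ihe =>
    obtain ⟨⟨k, rfl⟩, h⟩ := h
    intro s l
    refine ⟨trivial, l k he.2.1, fun j hj => ihe h he.2.2 fun r hr => ?_⟩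
    have := l k he.2.1
    simp only [eval] at hj
    rw [RamState.reg_setReg]
    split
    · omega
    · exact l r hr

/-- An expression used as a formula holds if its value is not `0`. -/
def Holds (e : RamExpr) (s : RamState) : Prop := e.eval s ≠ 0

instance (e : RamExpr) (s : RamState) : Decidable (e.Holds s) := inferInstanceAs (Decidable (_ ≠ _))

/-- `a = b` -/
def eq (a b : RamExpr) : RamExpr := sub (lit 1) (add (sub a b) (sub b a))

/-- `a ≠ b` -/
def ne (a b : RamExpr) : RamExpr := add (sub a b) (sub b a)

/-- `a < b` -/
def lt (a b : RamExpr) : RamExpr := sub b a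

/-- `a ≤ b` -/
def le (a b : RamExpr) : RamExpr := sub (add b (lit 1)) a

/-- `a ∧ b` -/
def and (a b : RamExpr) : RamExpr := cond a b (lit 0)

/-- `a ∨ b` -/
def or (a b : RamExpr) : RamExpr := cond a (lit 1) b

theorem holds_eq (a b : RamExpr) (s : RamState) : (eq a b).Holds s ↔ a.eval s = b.eval s := by
  simp only [eq, Holds, eval]; omega

theorem holds_ne (a b : RamExpr) (s : RamState) : (ne a b).Holds s ↔ a.eval s ≠ b.eval s := by
  simp only [ne, Holds, eval]; omega

theorem holds_lt (a b : RamExpr) (s : RamState) : (lt a b).Holds s ↔ a.eval s < b.eval s := by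
  simp only [lt, Holds, eval]; omega

theorem holds_le (a b : RamExpr) (s : RamState) : (le a b).Holds s ↔ a.eval s ≤ b.eval s := by
  simp only [le, Holds, eval]; omega

theorem holds_and (a b : RamExpr) (s : RamState) : (and a b).Holds s ↔ a.Holds s ∧ b.Holds s := by
  by_cases h : a.eval s = 0 <;> simp [and, Holds, eval, h]

theorem holds_or (a b : RamExpr) (s : RamState) : (or a b).Holds s ↔ a.Holds s ∨ b.Holds s := by
  by_cases h : a.eval s = 0 <;> simp [or, Holds, eval, h]

/-- A sum of natural numbers is nonzero exactly if a summand is, so bounded sums serve as bounded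
existential quantifiers. -/
theorem holds_sum (i : ℕ) (b e : RamExpr) (s : RamState) :
    (sum i b e).Holds s ↔ ∃ j < b.eval s, e.Holds (s.setReg i j) := by
  simp [Holds, eval]

theorem eval_lit (c : ℕ) (s : RamState) : (lit c).eval s = c := rfl

theorem eval_var (i : ℕ) (s : RamState) : (var i).eval s = s.reg i := rfl

theorem eval_add (a b : RamExpr) (s : RamState) : (add a b).eval s = a.eval s + b.eval s := rfl

theorem eval_sub (a b : RamExpr) (s : RamState) : (sub a b).eval s = a.eval s - b.eval s := rfl

theorem eval_load (a : ℕ) (e : RamExpr) (s : RamState) : (load a e).eval s = s.mem a (e.eval s) :=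
  rfl

theorem eval_sum (i : ℕ) (b e : RamExpr) (s : RamState) :
    (sum i b e).eval s = ∑ j ∈ Finset.range (b.eval s), e.eval (s.setReg i j) := rfl

theorem eval_cond (c a b : RamExpr) (s : RamState) :
    (cond c a b).eval s = if c.Holds s then a.eval s else b.eval s := rfl

end RamExpr

/-! ### Frame conditions and loop invariants for commands -/

namespace RamCmd

/-- The registers that a command may change. -/
def Writes (r : ℕ) : RamCmd → Prop
  | assign i _ => r = i
  | store _ _ _ => False
  | seq c d => c.Writes r ∨ d.Writes r
  | forLoop i _ c => r = i ∨ c.Writes r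

/-- The memories that a command may change. -/
def Stores (a : ℕ) : RamCmd → Prop
  | assign _ _ => False
  | store b _ _ => a = b
  | seq c d => c.Stores a ∨ d.Stores a
  | forLoop _ _ c => c.Stores a

theorem reg_run {r : ℕ} {c : RamCmd} (h : ¬ c.Writes r) (s : RamState) :
    (c.run s).reg r = s.reg r := by
  induction c generalizing s with
  | assign i e => exact (RamState.reg_setReg _ _ _ _).trans (if_neg h)
  | store a j e => rfl
  | seq c d ihc ihd =>
    rw [run, ihd fun h' => h (.inr h'), ihc fun h' => h (.inl h')]
  | forLoop i b c ih =>
    rw [run_forLoop]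
    induction b.eval s with
    | zero => rfl
    | succ k ihk =>
      rw [rounds_succ, ih fun h' => h (.inr h'), RamState.reg_setReg, if_neg fun h' => h (.inl h'),
        ihk]

theorem mem_run {a : ℕ} {c : RamCmd} (h : ¬ c.Stores a) (s : RamState) :
    (c.run s).mem a = s.mem a := by
  induction c generalizing s with
  | assign i e => rfl
  | store b j e =>
    funext k
    rw [run, RamState.mem_setMem, if_neg fun h' => h h'.1]
  | seq c d ihc ihd =>
    rw [run, ihd fun h' => h (.inr h'), ihc fun h' => h (.inl h')]
  | forLoop i b c ih =>
    rw [run_forLoop]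
    induction b.eval s with
    | zero => rfl
    | succ k ihk => rw [rounds_succ, ih h, RamState.mem_setReg, ihk]

/-- The command respects the bound `M` on the loops and leaves a state with the property `Q`. -/
def Ensures (M : ℕ) (c : RamCmd) (s : RamState) (Q : RamState → Prop) : Prop :=
  c.LoopsLE M s ∧ Q (c.run s)

theorem Ensures.mono {M : ℕ} {c : RamCmd} {s : RamState} {Q Q' : RamState → Prop}
    (h : c.Ensures M s Q) (hQ : ∀ s, Q s → Q' s) : c.Ensures M s Q' := ⟨h.1, hQ _ h.2⟩

theorem Ensures.seq {M : ℕ} {c d : RamCmd} {s : RamState} {Q Q' : RamState → Prop}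
    (h : c.Ensures M s Q) (h' : ∀ s, Q s → d.Ensures M s Q') : (c.seq d).Ensures M s Q' :=
  ⟨⟨h.1, (h' _ h.2).1⟩, (h' _ h.2).2⟩

/-- The invariant rule: `I k` describes the state before round `k`. The number of rounds is read
once, before the loop. -/
theorem Ensures.forLoop {M i r : ℕ} {c : RamCmd} {s : RamState}
    (I : ℕ → RamState → Prop) (hM : s.reg r ≤ M) (h0 : I 0 s)
    (h : ∀ k < s.reg r, ∀ s', I k s' → c.Ensures M (s'.setReg i k) (I (k + 1))) :
    (RamCmd.forLoop i (.var r) c).Ensures M s (I (s.reg r)) := by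
  have key : ∀ k ≤ s.reg r, I k (c.rounds i s k) := by
    intro k
    induction k with
    | zero => exact fun _ => h0
    | succ k ih => exact fun hk => (h k hk _ (ih (by omega))).2
  exact ⟨⟨trivial, hM, fun k hk => (h k hk _ (key k hk.le)).1⟩, key _ le_rfl⟩

end RamCmd

/-! ### The algorithm, on the level of functions

The input word `w` has the entries `n`, `ℓ`, the `n` vertex codes and the `n * n` pair codes.  The
*slots* are the places `j < n + n * n` of the codes.  A guess `D` assigns a rank to every special
vertex (that is, missing or incident with a missing edge) and a page to every missing edge. -/

namespace LayoutSearch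

/-- the code of the vertex `v` -/
def vcode (w : ℕ → ℕ) (v : ℕ) : ℕ := w (2 + v)

/-- the code of the pair `u, v` -/
def pcode (n : ℕ) (w : ℕ → ℕ) (u v : ℕ) : ℕ := w (2 + n + (u * n + v))

/-- `u` is missing or incident with a missing edge. -/
def Special (n : ℕ) (w : ℕ → ℕ) (u : ℕ) : Prop := vcode w u = 0 ∨ ∃ v < n, pcode n w u v = 1

/-- The slot `j` is relevant for the guess. -/
def Slot (n : ℕ) (w : ℕ → ℕ) (j : ℕ) : Prop := j < n ∧ Special n w j ∨ n ≤ j ∧ w (2 + j) = 1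

/-- the guessed page of the missing edge `uv` -/
def gpage (n : ℕ) (D : ℕ → ℕ) (u v : ℕ) : ℕ := D (n + (u * n + v))

/-- `0` for an old vertex, and a positive number that depends on the guessed rank for a missing
vertex -/
def tie (w D : ℕ → ℕ) (v : ℕ) : ℕ := if vcode w v = 0 then D v + 1 else 0

/-- The spine order that belongs to the positions `x`: a missing vertex at position `r` comes after
exactly `r` old vertices, and the guess decides between missing vertices at the same position. -/
def Left (w D x : ℕ → ℕ) (u v : ℕ) : Prop := x u < x v ∨ x u = x v ∧ tie w D u < tie w D v

/-- The position of `v` is too small. -/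
def TooSmall (n : ℕ) (w D x : ℕ → ℕ) (v : ℕ) : Prop :=
  (∃ u < n, Special n w u ∧ Special n w v ∧ D u < D v ∧ Left w D x v u) ∨
  (∃ u < n, ∃ a < n, ∃ b < n, pcode n w v u = 1 ∧ D v < D u ∧ pcode n w a b = gpage n D v u + 2 ∧
    vcode w a < vcode w b ∧ Left w D x v a ∧ Left w D x b u) ∨
  (∃ u < n, ∃ a < n, ∃ b < n, pcode n w u v = 1 ∧ D u < D v ∧ pcode n w a b = gpage n D u v + 2 ∧
    vcode w a < vcode w b ∧ Left w D x a u ∧ Left w D x v b)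

/-- The guess `D` together with the positions `x` does not describe a queue layout. -/
def Rejects (n ℓ : ℕ) (w D x : ℕ → ℕ) : Prop :=
  (∃ u < n, ∃ v < n, Special n w u ∧ Special n w v ∧ u ≠ v ∧ D u = D v) ∨
  (∃ u < n, ∃ v < n, pcode n w u v = 1 ∧ ℓ ≤ gpage n D u v) ∨
  (∃ u < n, ∃ v < n, ∃ a < n, ∃ b < n, pcode n w u v = 1 ∧ pcode n w a b = 1 ∧
    gpage n D u v = gpage n D a b ∧ D u < D a ∧ D a < D b ∧ D b < D v) ∨
  (∃ v < n, TooSmall n w D x v) ∨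
  (∃ v < n, vcode w v ≠ 0 ∧ x v ≠ vcode w v)

open Classical in
/-- the number of relevant slots below `j` -/
noncomputable def slotCount (n : ℕ) (w : ℕ → ℕ) (j : ℕ) : ℕ := {i ∈ Finset.range j | Slot n w i}.card

/-- the base of the digits of a guess -/
noncomputable def base (n ℓ : ℕ) (w : ℕ → ℕ) : ℕ := ℓ + slotCount n w (n + n * n)

/-- the number of guesses -/
noncomputable def guesses (n ℓ : ℕ) (w : ℕ → ℕ) : ℕ :=
  base n ℓ w ^ slotCount n w (n + n * n)

/-- the guess with number `g` -/
noncomputable def guess (n ℓ : ℕ) (w : ℕ → ℕ) (g j : ℕ) : ℕ :=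
  if j < n + n * n then g / base n ℓ w ^ slotCount n w j % base n ℓ w else 0

/-- the initial positions -/
def start (n : ℕ) (w : ℕ → ℕ) (v : ℕ) : ℕ := if v < n then vcode w v else 0

open Classical in
/-- Raise the position of `v` if it is too small. -/
noncomputable def raise (n : ℕ) (w D : ℕ → ℕ) (x : ℕ → ℕ) (v : ℕ) : ℕ → ℕ :=
  Function.update x v (x v + if TooSmall n w D x v then 1 else 0)

/-- Treat the vertices below `k` one after the other. -/
noncomputable def sweep (n : ℕ) (w D : ℕ → ℕ) (x : ℕ → ℕ) : ℕ → ℕ → ℕ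
  | 0 => x
  | k + 1 => raise n w D (sweep n w D x k) k

/-- the positions after `k` sweeps -/
noncomputable def sweeps (n : ℕ) (w D : ℕ → ℕ) : ℕ → ℕ → ℕ
  | 0 => start n w
  | k + 1 => sweep n w D (sweeps n w D k) n

/-- The guess `D` leads to a solution. -/
def Succeeds (n ℓ : ℕ) (w D : ℕ → ℕ) : Prop := ¬ Rejects n ℓ w D (sweeps n w D (n * n + 1))

/-! ### The algorithm as a command

Register `0` holds the answer, `1` holds `n`, `2` holds `ℓ`, `3` the base, `4` the number of guesses,
`5` the current guess, `6` the number of slots, `17` the number of sweeps and `18` the digits that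
are still to be extracted.  Memory `1` holds the positions and memory `2` the guess. -/

open RamExpr RamCmd

def vcodeExpr (i : ℕ) : RamExpr := load 0 (add (lit 2) (var i))

def flatExpr (i j : ℕ) : RamExpr := add (sum 15 (var i) (var 1)) (var j)

def pcodeExpr (i j : ℕ) : RamExpr := load 0 (add (add (lit 2) (var 1)) (flatExpr i j))

def specialExpr (i : ℕ) : RamExpr :=
  or (eq (vcodeExpr i) (lit 0)) (sum 14 (var 1) (eq (pcodeExpr i 14) (lit 1)))

def slotExpr : RamExpr :=
  or (and (lt (var 7) (var 1)) (specialExpr 7))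
    (and (le (var 1) (var 7)) (eq (load 0 (add (lit 2) (var 7))) (lit 1)))

def rankExpr (i : ℕ) : RamExpr := load 2 (var i)

def gpageExpr (i j : ℕ) : RamExpr := load 2 (add (var 1) (flatExpr i j))

def posExpr (i : ℕ) : RamExpr := load 1 (var i)

def tieExpr (i : ℕ) : RamExpr :=
  cond (eq (vcodeExpr i) (lit 0)) (add (rankExpr i) (lit 1)) (lit 0)

def leftExpr (i j : ℕ) : RamExpr :=
  or (lt (posExpr i) (posExpr j))
    (and (eq (posExpr i) (posExpr j)) (lt (tieExpr i) (tieExpr j)))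

def tooSmallExpr : RamExpr :=
  or (sum 10 (var 1) (and (specialExpr 10) (and (specialExpr 8)
    (and (lt (rankExpr 10) (rankExpr 8)) (leftExpr 8 10))))) <|
  or (sum 10 (var 1) (sum 11 (var 1) (sum 12 (var 1) (and (eq (pcodeExpr 8 10) (lit 1))
    (and (lt (rankExpr 8) (rankExpr 10)) (and (eq (pcodeExpr 11 12) (add (gpageExpr 8 10) (lit 2)))
    (and (lt (vcodeExpr 11) (vcodeExpr 12)) (and (leftExpr 8 11) (leftExpr 12 10))))))))) <|
  sum 10 (var 1) (sum 11 (var 1) (sum 12 (var 1) (and (eq (pcodeExpr 10 8) (lit 1))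
    (and (lt (rankExpr 10) (rankExpr 8)) (and (eq (pcodeExpr 11 12) (add (gpageExpr 10 8) (lit 2)))
    (and (lt (vcodeExpr 11) (vcodeExpr 12)) (and (leftExpr 11 10) (leftExpr 8 12))))))))

def rejectsExpr : RamExpr :=
  or (sum 10 (var 1) (sum 11 (var 1) (and (specialExpr 10) (and (specialExpr 11)
    (and (ne (var 10) (var 11)) (eq (rankExpr 10) (rankExpr 11))))))) <|
  or (sum 10 (var 1) (sum 11 (var 1) (and (eq (pcodeExpr 10 11) (lit 1))
    (le (var 2) (gpageExpr 10 11))))) <|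
  or (sum 10 (var 1) (sum 11 (var 1) (sum 12 (var 1) (sum 13 (var 1)
    (and (eq (pcodeExpr 10 11) (lit 1)) (and (eq (pcodeExpr 12 13) (lit 1))
    (and (eq (gpageExpr 10 11) (gpageExpr 12 13)) (and (lt (rankExpr 10) (rankExpr 12))
    (and (lt (rankExpr 12) (rankExpr 13)) (lt (rankExpr 13) (rankExpr 11))))))))))) <|
  or (sum 8 (var 1) tooSmallExpr)
    (sum 10 (var 1) (and (ne (vcodeExpr 10) (lit 0)) (ne (posExpr 10) (vcodeExpr 10))))

/-! ### The expressions compute the intended predicates -/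

theorem eval_vcodeExpr (s : RamState) (i : ℕ) :
    (vcodeExpr i).eval s = vcode (s.mem 0) (s.reg i) := rfl

/-- Multiplication is a sum with a constant summand. -/
theorem eval_flatExpr (s : RamState) (i : ℕ) {j : ℕ} :
    (flatExpr i j).eval s = s.reg i * s.reg 1 + s.reg j := by
  simp [flatExpr, eval_sum, eval_var, eval_add, RamState.reg_setReg]

theorem eval_pcodeExpr (s : RamState) (i j : ℕ) :
    (pcodeExpr i j).eval s = pcode (s.reg 1) (s.mem 0) (s.reg i) (s.reg j) := by
  simp [pcodeExpr, eval_load, eval_add, eval_lit, eval_var, eval_flatExpr, pcode]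

theorem eval_gpageExpr (s : RamState) (i j : ℕ) :
    (gpageExpr i j).eval s = gpage (s.reg 1) (s.mem 2) (s.reg i) (s.reg j) := by
  simp [gpageExpr, eval_load, eval_add, eval_var, eval_flatExpr, gpage]

theorem eval_rankExpr (s : RamState) (i : ℕ) : (rankExpr i).eval s = s.mem 2 (s.reg i) := rfl

theorem eval_posExpr (s : RamState) (i : ℕ) : (posExpr i).eval s = s.mem 1 (s.reg i) := rfl

/-- The index `14` is bound inside `specialExpr`; the hypothesis avoids its capture. -/
theorem holds_specialExpr (s : RamState) {i : ℕ} (h : i ≠ 14) :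
    (specialExpr i).Holds s ↔ Special (s.reg 1) (s.mem 0) (s.reg i) := by
  simp [specialExpr, holds_or, holds_sum, holds_eq, eval_vcodeExpr, eval_pcodeExpr, eval_lit,
    eval_var, RamState.reg_setReg, Special, h]

theorem holds_slotExpr (s : RamState) :
    slotExpr.Holds s ↔ Slot (s.reg 1) (s.mem 0) (s.reg 7) := by
  simp [slotExpr, holds_or, holds_specialExpr, holds_lt, holds_and, holds_le, holds_eq, eval_lit,
    eval_add, eval_load, eval_var, Slot]

theorem eval_tieExpr (s : RamState) (i : ℕ) :
    (tieExpr i).eval s = tie (s.mem 0) (s.mem 2) (s.reg i) := by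
  simp [tieExpr, eval_cond, holds_eq, eval_vcodeExpr, eval_rankExpr, eval_lit, eval_add, tie]

theorem holds_leftExpr (s : RamState) (i j : ℕ) :
    (leftExpr i j).Holds s ↔ Left (s.mem 0) (s.mem 2) (s.mem 1) (s.reg i) (s.reg j) := by
  simp [leftExpr, holds_or, holds_and, holds_lt, holds_eq, eval_posExpr, eval_tieExpr, Left]

theorem holds_tooSmallExpr (s : RamState) : tooSmallExpr.Holds s ↔
    TooSmall (s.reg 1) (s.mem 0) (s.mem 2) (s.mem 1) (s.reg 8) := by
  simp [tooSmallExpr, holds_or, holds_sum, holds_and, holds_leftExpr, holds_specialExpr, holds_lt,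
    holds_eq, eval_var, eval_lit, eval_add, eval_vcodeExpr, eval_rankExpr, eval_gpageExpr,
    eval_pcodeExpr, RamState.reg_setReg, TooSmall]

theorem holds_rejectsExpr (s : RamState) : rejectsExpr.Holds s ↔
    Rejects (s.reg 1) (s.reg 2) (s.mem 0) (s.mem 2) (s.mem 1) := by
  simp [rejectsExpr, holds_or, holds_sum, holds_and, holds_tooSmallExpr, holds_specialExpr,
    holds_lt, holds_le, holds_ne, holds_eq, eval_var, eval_lit, eval_vcodeExpr, eval_rankExpr,
    eval_gpageExpr, eval_pcodeExpr, eval_posExpr, RamState.reg_setReg, Rejects]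

end LayoutSearch

namespace RamCmd

/-- Thanks to this, the specification of a command need only mention what the command computes. -/
theorem Ensures.frame {M : ℕ} {c : RamCmd} {s : RamState} {Q : RamState → Prop}
    (h : c.Ensures M s Q) : c.Ensures M s fun s' => Q s' ∧ (∀ r, ¬ c.Writes r → s'.reg r = s.reg r) ∧
      ∀ a, ¬ c.Stores a → s'.mem a = s.mem a :=
  ⟨h.1, h.2, fun _ hr => reg_run hr s, fun _ ha => mem_run ha s⟩

end RamCmd

namespace LayoutSearch

open RamExpr RamCmd

/-! ### Bounded registers, division with remainder, and syntactic checks -/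

/-- All registers that the algorithm uses have a content of at most `M`. -/
def RegsLE (M : ℕ) (s : RamState) : Prop := ∀ r < 19, s.reg r ≤ M

theorem RegsLE.setReg {M x : ℕ} {s : RamState} (h : RegsLE M s) (i : ℕ) (hx : x ≤ M) :
    RegsLE M (s.setReg i x) := by
  intro r hr
  rw [RamState.reg_setReg]
  split
  · exact hx
  · exact h r hr

theorem RegsLE.loopsLE {M : ℕ} {s : RamState} (h : RegsLE M s) {e : RamExpr} (he : e.Below 19)
    (hv : e.VarBounded) : e.LoopsLE M s := hv.loopsLE he h

/-- the quotient of register `18` by register `3` -/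
def divExpr : RamExpr :=
  sum 16 (var 18) (cond (le (add (sum 15 (var 16) (var 3)) (var 3)) (var 18)) (lit 1) (lit 0))

/-- the remainder of register `18` modulo register `3` -/
def modExpr : RamExpr := sub (var 18) (sum 15 (var 3) divExpr)

/-- The quotient of `x` by `B` is the number of `i` with `(i + 1) * B ≤ x`, and the range `i < x`
contains all of them. -/
theorem eval_divExpr (s : RamState) (h : 0 < s.reg 3) : divExpr.eval s = s.reg 18 / s.reg 3 := by
  simp only [divExpr, eval_sum, eval_var, eval_cond, holds_le, eval_add, eval_lit,
    RamState.reg_setReg]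
  simp only [Nat.reduceEqDiff, if_true, if_false, Finset.sum_const, Finset.card_range, smul_eq_mul]
  rw [← Finset.card_filter]
  convert Finset.card_range (s.reg 18 / s.reg 3) using 2
  ext i
  have h1 : i * s.reg 3 + s.reg 3 = (i + 1) * s.reg 3 := by ring
  have h2 := Nat.div_le_self (s.reg 18) (s.reg 3)
  simp only [Finset.mem_filter, Finset.mem_range, h1, ← Nat.le_div_iff_mul_le h]
  omega

theorem eval_modExpr (s : RamState) (h : 0 < s.reg 3) : modExpr.eval s = s.reg 18 % s.reg 3 := by
  simp only [modExpr, eval_sub, eval_sum, eval_var]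
  rw [Finset.sum_congr rfl fun j _ => eval_divExpr (s.setReg 15 j) (by simpa [RamState.reg_setReg])]
  simp only [RamState.reg_setReg, Nat.reduceEqDiff, if_false, Finset.sum_const, Finset.card_range,
    smul_eq_mul]
  have := Nat.div_add_mod (s.reg 18) (s.reg 3)
  omega

theorem slotExpr_below : slotExpr.Below 19 := by
  simp [slotExpr, RamExpr.or, RamExpr.and, RamExpr.lt, RamExpr.le, RamExpr.eq, specialExpr,
    vcodeExpr, pcodeExpr, flatExpr, RamExpr.Below]

theorem slotExpr_varBounded : slotExpr.VarBounded := by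
  simp [slotExpr, RamExpr.or, RamExpr.and, RamExpr.lt, RamExpr.le, RamExpr.eq, specialExpr,
    vcodeExpr, pcodeExpr, flatExpr, VarBounded]

theorem tooSmallExpr_below : tooSmallExpr.Below 19 := by
  simp [tooSmallExpr, RamExpr.or, RamExpr.and, RamExpr.lt, RamExpr.eq, specialExpr, leftExpr,
    tieExpr, posExpr, rankExpr, gpageExpr, vcodeExpr, pcodeExpr, flatExpr, RamExpr.Below]

theorem tooSmallExpr_varBounded : tooSmallExpr.VarBounded := by
  simp [tooSmallExpr, RamExpr.or, RamExpr.and, RamExpr.lt, RamExpr.eq, specialExpr, leftExpr,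
    tieExpr, posExpr, rankExpr, gpageExpr, vcodeExpr, pcodeExpr, flatExpr, VarBounded]

theorem rejectsExpr_below : rejectsExpr.Below 19 := by
  have := tooSmallExpr_below
  simp [rejectsExpr, RamExpr.or, RamExpr.and, RamExpr.lt, RamExpr.le, RamExpr.ne, RamExpr.eq,
    specialExpr, posExpr, rankExpr, gpageExpr, vcodeExpr, pcodeExpr, flatExpr, RamExpr.Below, this]

theorem rejectsExpr_varBounded : rejectsExpr.VarBounded := by
  have := tooSmallExpr_varBounded
  simp [rejectsExpr, RamExpr.or, RamExpr.and, RamExpr.lt, RamExpr.le, RamExpr.ne, RamExpr.eq,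
    specialExpr, posExpr, rankExpr, gpageExpr, vcodeExpr, pcodeExpr, flatExpr, VarBounded, this]

theorem divExpr_below : divExpr.Below 19 := by simp [divExpr, RamExpr.le, RamExpr.Below]

theorem divExpr_varBounded : divExpr.VarBounded := by simp [divExpr, RamExpr.le, VarBounded]

theorem modExpr_below : modExpr.Below 19 := by
  simp [modExpr, RamExpr.Below, divExpr_below]

theorem modExpr_varBounded : modExpr.VarBounded := by
  simp [modExpr, VarBounded, divExpr_varBounded]

theorem sweep_of_le (n : ℕ) (w D x : ℕ → ℕ) {k v : ℕ} (h : k ≤ v) : sweep n w D x k v = x v := by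
  induction k with
  | zero => rfl
  | succ k ih =>
    rw [sweep, raise, Function.update_of_ne (by omega), ih (by omega)]

/-- The cells from `n` on stay `0`, so memory `1` equals the positions as a function, also when it
is reused for the next guess. -/
theorem sweeps_of_le {n : ℕ} (w D : ℕ → ℕ) (k : ℕ) {v : ℕ} (h : n ≤ v) :
    sweeps n w D k v = 0 := by
  induction k with
  | zero => rw [sweeps, start, if_neg (by omega)]
  | succ k ih => rw [sweeps, sweep_of_le _ _ _ _ h, ih]

/-! ### The commands -/

/-- Compute the sizes of the instance and of the search space. -/
def sizesCmd : RamCmd :=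
  .seq (assign 1 (load 0 (lit 0))) <| .seq (assign 2 (load 0 (lit 1))) <|
  .seq (assign 6 (add (var 1) (sum 15 (var 1) (var 1)))) <|
  .seq (assign 17 (add (sum 15 (var 1) (var 1)) (lit 1))) <|
  .seq (assign 3 (add (var 2) (sum 7 (var 6) (cond slotExpr (lit 1) (lit 0))))) <|
  .seq (assign 4 (lit 1)) <|
  .seq (.forLoop 7 (var 6) (assign 4 (cond slotExpr (sum 15 (var 3) (var 4)) (var 4)))) <|
  assign 0 (lit 0)

/-- Write the guess with the number in register `5` into memory `2`. -/
def guessCmd : RamCmd :=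
  .seq (assign 18 (var 5)) <| .forLoop 7 (var 6) <| .seq (store 2 (var 7) modExpr) <|
  assign 18 (cond slotExpr divExpr (var 18))

/-- Write the initial positions into memory `1`. -/
def startCmd : RamCmd := .forLoop 8 (var 1) <| store 1 (var 8) (vcodeExpr 8)

/-- Raise the positions that are too small. -/
def sweepCmd : RamCmd :=
  .forLoop 8 (var 1) <| store 1 (var 8) (add (posExpr 8) (cond tooSmallExpr (lit 1) (lit 0)))

/-- Try all guesses. -/
def searchCmd : RamCmd :=
  .seq sizesCmd <| .forLoop 5 (var 4) <| .seq guessCmd <| .seq startCmd <|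
  .seq (.forLoop 9 (var 17) sweepCmd) <| assign 0 (cond rejectsExpr (var 0) (lit 1))

theorem searchCmd_below : searchCmd.Below 19 := by
  simp [searchCmd, sizesCmd, guessCmd, startCmd, sweepCmd, RamCmd.Below, RamExpr.Below,
    slotExpr_below, modExpr_below, divExpr_below, tooSmallExpr_below, rejectsExpr_below, vcodeExpr,
    posExpr]

theorem slotCount_succ (n : ℕ) (w : ℕ → ℕ) (j : ℕ) [Decidable (Slot n w j)] :
    slotCount n w (j + 1) = slotCount n w j + if Slot n w j then 1 else 0 := by
  unfold slotCount
  rw [Finset.range_add_one, Finset.filter_insert]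
  split <;> simp

theorem ensures_assign {M i : ℕ} {e : RamExpr} {s : RamState} {Q : RamState → Prop}
    (he : e.Below 19) (hv : e.VarBounded) (hs : RegsLE M s) (hQ : Q (s.setReg i (e.eval s))) :
    (assign i e).Ensures M s Q := ⟨hs.loopsLE he hv, hQ⟩

theorem ensures_store {M a : ℕ} {j e : RamExpr} {s : RamState} {Q : RamState → Prop}
    (hj : j.Below 19 ∧ j.VarBounded) (he : e.Below 19) (hv : e.VarBounded) (hs : RegsLE M s)
    (hQ : Q (s.setMem a (j.eval s) (e.eval s))) : (store a j e).Ensures M s Q :=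
  ⟨⟨hs.loopsLE hj.1 hj.2, hs.loopsLE he hv⟩, hQ⟩

theorem ensures_startCmd {M n : ℕ} {w : ℕ → ℕ} {s : RamState} (hs : RegsLE M s) (h1 : s.reg 1 = n)
    (hw : s.mem 0 = w) (h0 : ∀ v, n ≤ v → s.mem 1 v = 0) :
    startCmd.Ensures M s fun s' => RegsLE M s' ∧ s'.mem 1 = start n w := by
  have hn : n ≤ M := h1 ▸ hs 1 (by decide)
  refine (Ensures.forLoop (fun k s' => RegsLE M s' ∧ s'.mem 0 = w ∧
    (∀ v < k, s'.mem 1 v = vcode w v) ∧ ∀ v, n ≤ v → s'.mem 1 v = 0) ?_ ?_ ?_).mono ?_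
  · simpa [h1] using hn
  · exact ⟨hs, hw, fun v hv => by omega, h0⟩
  · rintro k hk s' ⟨hs', hw', hv', h0'⟩
    rw [h1] at hk
    refine ensures_store (by simp [RamExpr.Below, VarBounded])
      (by simp [vcodeExpr, RamExpr.Below]) (by simp [vcodeExpr, VarBounded])
      (hs'.setReg 8 (by omega)) ⟨?_, ?_, fun v hv => ?_, fun v hv => ?_⟩
    · exact hs'.setReg 8 (by omega)
    · funext j
      simp [RamState.mem_setMem, hw']
    · simp only [RamState.mem_setMem, eval_var, eval_vcodeExpr, RamState.reg_setReg, if_true,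
        true_and, RamState.mem_setReg, hw']
      split
      · simp_all
      · exact hv' v (by omega)
    · simp only [RamState.mem_setMem, eval_var, RamState.reg_setReg, if_true, true_and,
        RamState.mem_setReg]
      rw [if_neg (by omega), h0' v hv]
  · rintro s' ⟨hs', -, hv', h0'⟩
    rw [h1] at hv'
    refine ⟨hs', ?_⟩
    funext v
    unfold start
    split
    · next h => exact hv' v h
    · next h => exact h0' v (by omega)

theorem ensures_sweepCmd {M n : ℕ} {w D x : ℕ → ℕ} {s : RamState} (hs : RegsLE M s)
    (h1 : s.reg 1 = n) (hw : s.mem 0 = w) (hD : s.mem 2 = D) (hx : s.mem 1 = x) :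
    sweepCmd.Ensures M s fun s' => RegsLE M s' ∧ s'.mem 1 = sweep n w D x n := by
  have hn : n ≤ M := h1 ▸ hs 1 (by decide)
  refine (Ensures.forLoop (fun k s' => RegsLE M s' ∧ s'.reg 1 = n ∧ s'.mem 0 = w ∧ s'.mem 2 = D ∧
    s'.mem 1 = sweep n w D x k) ?_ ?_ ?_).mono ?_
  · simpa [h1] using hn
  · exact ⟨hs, h1, hw, hD, hx⟩
  · rintro k hk s' ⟨hs', h1', hw', hD', hx'⟩
    rw [h1] at hk
    refine ensures_store (by simp [RamExpr.Below, VarBounded])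
      (by simp [posExpr, RamExpr.Below, tooSmallExpr_below])
      (by simp [posExpr, VarBounded, tooSmallExpr_varBounded])
      (hs'.setReg 8 (by omega)) ⟨?_, ?_, ?_, ?_, ?_⟩
    · exact hs'.setReg 8 (by omega)
    · simpa [RamState.reg_setReg] using h1'
    · funext j
      simp [RamState.mem_setMem, hw']
    · funext j
      simp [RamState.mem_setMem, hD']
    · classical
      funext j
      simp [RamState.mem_setMem, sweep, raise, Function.update_apply, eval_var, eval_add, eval_cond,
        eval_posExpr, eval_lit, holds_tooSmallExpr, RamState.reg_setReg, h1', hw', hD', hx']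
  · rintro s' ⟨hs', -, -, -, hx'⟩
    rw [h1] at hx'
    exact ⟨hs', hx'⟩

theorem ensures_sweeps {M n : ℕ} {w D : ℕ → ℕ} {s : RamState} (hs : RegsLE M s)
    (h1 : s.reg 1 = n) (h17 : s.reg 17 = n * n + 1) (hw : s.mem 0 = w) (hD : s.mem 2 = D)
    (hx : s.mem 1 = start n w) : (RamCmd.forLoop 9 (var 17) sweepCmd).Ensures M s fun s' =>
      RegsLE M s' ∧ s'.mem 1 = sweeps n w D (n * n + 1) := by
  have hn : n * n + 1 ≤ M := h17 ▸ hs 17 (by decide)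
  refine (Ensures.forLoop (fun k s' => RegsLE M s' ∧ s'.reg 1 = n ∧ s'.mem 0 = w ∧ s'.mem 2 = D ∧
    s'.mem 1 = sweeps n w D k) ?_ ?_ ?_).mono ?_
  · simpa [h17] using hn
  · exact ⟨hs, h1, hw, hD, hx⟩
  · rintro k hk s' ⟨hs', h1', hw', hD', hx'⟩
    rw [h17] at hk
    refine (ensures_sweepCmd (hs'.setReg 9 (by omega)) (by simpa [RamState.reg_setReg] using h1')
      (by simpa using hw') (by simpa using hD') (by simpa using hx')).frame.mono ?_
    rintro s'' ⟨⟨hs'', hx''⟩, hr, hm⟩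
    refine ⟨hs'', ?_, ?_, ?_, hx''⟩
    · simpa [hr 1 (by simp [sweepCmd, Writes]), RamState.reg_setReg] using h1'
    · simpa [hm 0 (by simp [sweepCmd, Stores])] using hw'
    · simpa [hm 2 (by simp [sweepCmd, Stores])] using hD'
  · rintro s' ⟨hs', -, -, -, hx'⟩
    rw [h17] at hx'
    exact ⟨hs', hx'⟩

theorem ensures_guessCmd {M n ℓ g : ℕ} {w : ℕ → ℕ} {s : RamState} (hs : RegsLE M s)
    (h1 : s.reg 1 = n) (h3 : s.reg 3 = base n ℓ w) (hB : 0 < base n ℓ w) (h5 : s.reg 5 = g)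
    (h6 : s.reg 6 = n + n * n) (hw : s.mem 0 = w) (h0 : ∀ j, n + n * n ≤ j → s.mem 2 j = 0) :
    guessCmd.Ensures M s fun s' => RegsLE M s' ∧ s'.mem 2 = guess n ℓ w g := by
  have hm : n + n * n ≤ M := h6 ▸ hs 6 (by decide)
  have hg : g ≤ M := h5 ▸ hs 5 (by decide)
  refine Ensures.seq (Q := fun s' => s' = s.setReg 18 g)
    (ensures_assign (by simp [RamExpr.Below]) (by simp [VarBounded]) hs (by rw [eval_var, h5])) ?_
  rintro _ rfl
  have h6' : (s.setReg 18 g).reg 6 = n + n * n := by simp [RamState.reg_setReg, h6]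
  refine (Ensures.forLoop (fun k s' => RegsLE M s' ∧ s'.reg 1 = n ∧ s'.reg 3 = base n ℓ w ∧
    s'.reg 18 = g / base n ℓ w ^ slotCount n w k ∧ s'.mem 0 = w ∧
    (∀ j < k, s'.mem 2 j = g / base n ℓ w ^ slotCount n w j % base n ℓ w) ∧
    ∀ j, n + n * n ≤ j → s'.mem 2 j = 0) ?_ ?_ ?_).mono ?_
  · rwa [h6']
  · exact ⟨hs.setReg 18 hg, by simpa [RamState.reg_setReg], by simpa [RamState.reg_setReg],
      by simp [RamState.reg_setReg, slotCount], hw, fun j hj => by omega, h0⟩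
  · rintro k hk s' ⟨hs', h1', h3', h18', hw', hj', h0'⟩
    rw [h6'] at hk
    have hs₁ := hs'.setReg 7 (x := k) (by omega)
    refine Ensures.seq (Q := fun s'' => s'' = (s'.setReg 7 k).setMem 2 k
      (g / base n ℓ w ^ slotCount n w k % base n ℓ w))
      (ensures_store (by simp [RamExpr.Below, VarBounded]) modExpr_below modExpr_varBounded hs₁ ?_)
      ?_
    · rw [eval_modExpr _ (by simpa [RamState.reg_setReg, h3'] using hB)]
      simp [eval_var, RamState.reg_setReg, h18', h3']
    · rintro _ rfl
      -- The number of the guess is divided by the base at relevant slots only, so the quotient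
      -- before slot `k` has lost exactly `slotCount n w k` digits. Irrelevant slots receive a junk
      -- digit.
      have hd : (cond slotExpr divExpr (var 18)).eval ((s'.setReg 7 k).setMem 2 k
          (g / base n ℓ w ^ slotCount n w k % base n ℓ w)) =
          g / base n ℓ w ^ slotCount n w (k + 1) := by
        classical
        rw [eval_cond, slotCount_succ, eval_divExpr _ (by simpa [RamState.reg_setReg, h3'] using hB)]
        have hm0 : ((s'.setReg 7 k).setMem 2 k
          (g / base n ℓ w ^ slotCount n w k % base n ℓ w)).mem 0 = w := by
          funext j
          simp [RamState.mem_setMem, hw']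
        simp only [holds_slotExpr, hm0, RamState.reg_setMem, RamState.reg_setReg, eval_var]
        simp only [Nat.reduceEqDiff, if_true, if_false, h1', h3', h18', OfNat.one_ne_ofNat]
        split
        · rw [pow_succ, Nat.div_div_eq_div_mul]
        · rfl
      refine ensures_assign (by simp [RamExpr.Below, slotExpr_below, divExpr_below])
        (by simp [VarBounded, slotExpr_varBounded, divExpr_varBounded]) hs₁ ?_
      rw [hd]
      refine ⟨RegsLE.setReg (s := RamState.setMem _ _ _ _) hs₁ _ ((Nat.div_le_self _ _).trans hg),
        ?_, ?_, ?_, ?_, fun j hj => ?_, fun j hj => ?_⟩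
      · simpa [RamState.reg_setReg] using h1'
      · simpa [RamState.reg_setReg] using h3'
      · simp [RamState.reg_setReg]
      · funext j
        simp [RamState.mem_setMem, hw']
      · simp only [RamState.mem_setReg, RamState.mem_setMem, true_and]
        split
        · simp_all
        · exact hj' j (by omega)
      · simp only [RamState.mem_setReg, RamState.mem_setMem, true_and]
        rw [if_neg (by omega), h0' j hj]
  · rintro s' ⟨hs', -, -, -, -, hj', h0'⟩
    rw [h6'] at hj'
    refine ⟨hs', ?_⟩
    funext j
    unfold guess
    split
    · next h => exact hj' j h
    · next h => exact h0' j (by omega)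

/-! ### The whole search -/

/-- The state after the sizes have been computed. -/
structure Ready (M n ℓ : ℕ) (w : ℕ → ℕ) (s : RamState) : Prop where
  regs : RegsLE M s
  reg1 : s.reg 1 = n
  reg2 : s.reg 2 = ℓ
  reg3 : s.reg 3 = base n ℓ w
  reg4 : s.reg 4 = guesses n ℓ w
  reg6 : s.reg 6 = n + n * n
  reg17 : s.reg 17 = n * n + 1
  mem0 : s.mem 0 = w
  mem1 : ∀ v, n ≤ v → s.mem 1 v = 0
  mem2 : ∀ j, n + n * n ≤ j → s.mem 2 j = 0

theorem ensures_sizesCmd {M n ℓ : ℕ} {w : ℕ → ℕ} {s : RamState} (hs : RegsLE M s)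
    (hn : n + n * n + 1 ≤ M) (hℓ : ℓ ≤ M) (hB : base n ℓ w ≤ M) (hB0 : 0 < base n ℓ w)
    (hN : guesses n ℓ w ≤ M)
    (hw : s.mem 0 = w) (hw0 : w 0 = n) (hw1 : w 1 = ℓ) (h1 : s.mem 1 = 0) (h2 : s.mem 2 = 0) :
    sizesCmd.Ensures M s fun s' => Ready M n ℓ w s' ∧ s'.reg 0 = 0 := by
  refine Ensures.seq (Q := fun s' => RegsLE M s' ∧ s'.mem = s.mem ∧ s'.reg 1 = n)
    (ensures_assign (by simp [RamExpr.Below]) (by simp [VarBounded]) hs ?_) ?_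
  · have e : (load 0 (lit 0)).eval s = n := by simp [eval_load, eval_lit, hw, hw0]
    rw [e]
    exact ⟨hs.setReg _ (by omega), rfl, by simp [RamState.reg_setReg]⟩
  rintro s₁ ⟨hs₁, m₁, r1⟩
  refine Ensures.seq (Q := fun s' => RegsLE M s' ∧ s'.mem = s.mem ∧ s'.reg 1 = n ∧ s'.reg 2 = ℓ)
    (ensures_assign (by simp [RamExpr.Below]) (by simp [VarBounded]) hs₁ ?_) ?_
  · have e : (load 0 (lit 1)).eval s₁ = ℓ := by simp [eval_load, eval_lit, m₁, hw, hw1]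
    rw [e]
    exact ⟨hs₁.setReg _ hℓ, m₁, by simpa [RamState.reg_setReg], by simp [RamState.reg_setReg]⟩
  rintro s₂ ⟨hs₂, m₂, r1, r2⟩
  refine Ensures.seq (Q := fun s' => RegsLE M s' ∧ s'.mem = s.mem ∧ s'.reg 1 = n ∧ s'.reg 2 = ℓ ∧
    s'.reg 6 = n + n * n)
    (ensures_assign (by simp [RamExpr.Below]) (by simp [VarBounded]) hs₂ ?_) ?_
  · have e : (add (var 1) (sum 15 (var 1) (var 1))).eval s₂ = n + n * n := by
      simp [eval_sum, eval_var, eval_add, RamState.reg_setReg, r1]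
    rw [e]
    exact ⟨hs₂.setReg _ (by omega), m₂, by simpa [RamState.reg_setReg],
      by simpa [RamState.reg_setReg], by simp [RamState.reg_setReg]⟩
  rintro s₃ ⟨hs₃, m₃, r1, r2, r6⟩
  refine Ensures.seq (Q := fun s' => RegsLE M s' ∧ s'.mem = s.mem ∧ s'.reg 1 = n ∧ s'.reg 2 = ℓ ∧
    s'.reg 6 = n + n * n ∧ s'.reg 17 = n * n + 1)
    (ensures_assign (by simp [RamExpr.Below]) (by simp [VarBounded]) hs₃ ?_) ?_
  · have e : (add (sum 15 (var 1) (var 1)) (lit 1)).eval s₃ = n * n + 1 := by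
      simp [eval_sum, eval_var, eval_add, eval_lit, RamState.reg_setReg, r1]
    rw [e]
    exact ⟨hs₃.setReg _ (by omega), m₃, by simpa [RamState.reg_setReg],
      by simpa [RamState.reg_setReg], by simpa [RamState.reg_setReg], by simp [RamState.reg_setReg]⟩
  rintro s₄ ⟨hs₄, m₄, r1, r2, r6, r17⟩
  refine Ensures.seq (Q := fun s' => RegsLE M s' ∧ s'.mem = s.mem ∧ s'.reg 1 = n ∧ s'.reg 2 = ℓ ∧
    s'.reg 6 = n + n * n ∧ s'.reg 17 = n * n + 1 ∧ s'.reg 3 = base n ℓ w)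
    (ensures_assign (by simp [RamExpr.Below, slotExpr_below])
      (by simp [VarBounded, slotExpr_varBounded]) hs₄ ?_) ?_
  · have e : (add (var 2) (sum 7 (var 6) (cond slotExpr (lit 1) (lit 0)))).eval s₄ =
        base n ℓ w := by
      classical
      simp only [eval_add, eval_var, eval_sum, eval_cond, eval_lit, holds_slotExpr,
        RamState.mem_setReg, RamState.reg_setReg]
      simp only [OfNat.one_ne_ofNat, if_true, if_false, r1, r2, r6, m₄, hw, base, slotCount,
        Finset.card_filter]
    rw [e]
    exact ⟨hs₄.setReg _ hB, m₄, by simpa [RamState.reg_setReg],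
      by simpa [RamState.reg_setReg], by simpa [RamState.reg_setReg],
      by simpa [RamState.reg_setReg], by simp [RamState.reg_setReg]⟩
  rintro s₅ ⟨hs₅, m₅, r1, r2, r6, r17, r3⟩
  refine Ensures.seq (Q := fun s' => s' = s₅.setReg 4 1)
    (ensures_assign (by simp [RamExpr.Below]) (by simp [VarBounded]) hs₅ (by rw [eval_lit])) ?_
  rintro _ rfl
  have h6' : (s₅.setReg 4 1).reg 6 = n + n * n := by
    simp [RamState.reg_setReg, r6]
  refine Ensures.seq (Ensures.forLoop (fun k s' => RegsLE M s' ∧ s'.mem = s.mem ∧ s'.reg 1 = n ∧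
    s'.reg 2 = ℓ ∧ s'.reg 6 = n + n * n ∧ s'.reg 17 = n * n + 1 ∧ s'.reg 3 = base n ℓ w ∧
    s'.reg 4 = base n ℓ w ^ slotCount n w k) ?_ ?_ ?_) ?_
  · rw [h6']
    omega
  · refine ⟨hs₅.setReg _ (by omega), m₅, ?_, ?_, ?_, ?_, ?_, ?_⟩ <;>
      simp [RamState.reg_setReg, slotCount, *]
  · rintro k hk s' ⟨hs', m', q1, q2, q6, q17, q3, q4⟩
    rw [h6'] at hk
    have hs'' := hs'.setReg 7 (x := k) (by omega)
    refine ensures_assign (by simp [RamExpr.Below, slotExpr_below])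
      (by simp [VarBounded, slotExpr_varBounded]) hs'' ?_
    have e : (cond slotExpr (sum 15 (var 3) (var 4)) (var 4)).eval (s'.setReg 7 k) =
        base n ℓ w ^ slotCount n w (k + 1) := by
      classical
      rw [slotCount_succ]
      simp only [eval_var, eval_sum, eval_cond, holds_slotExpr, RamState.mem_setReg,
        RamState.reg_setReg]
      simp only [OfNat.one_ne_ofNat, if_true, if_false, q1, q3, q4, m', hw, Nat.reduceEqDiff,
        Finset.sum_const, Finset.card_range, smul_eq_mul]
      split
      · rw [pow_succ']
      · rfl
    -- The intermediate powers are bounded by the last one, which is the number of guesses; this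
    -- needs a positive base.
    have hle : base n ℓ w ^ slotCount n w (k + 1) ≤ M := by
      classical
      refine le_trans (Nat.pow_le_pow_right hB0 ?_) hN
      exact Finset.card_le_card
        (Finset.filter_subset_filter _ (Finset.range_subset_range.2 (by omega)))
    rw [e]
    refine ⟨hs''.setReg _ hle, m', ?_, ?_, ?_, ?_, ?_, ?_⟩ <;> simp [RamState.reg_setReg, *]
  rintro s₆ ⟨hs₆, m₆, r1, r2, r6, r17, r3, r4⟩
  rw [h6'] at r4
  refine ensures_assign (by simp [RamExpr.Below]) (by simp [VarBounded]) hs₆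
    ⟨⟨hs₆.setReg _ (by simp [eval_lit]), ?_, ?_, ?_, ?_, ?_, ?_, ?_, ?_, ?_⟩, ?_⟩ <;>
    simp [RamState.reg_setReg, guesses, eval_lit, *]

/-- The search finds a solution if one of the guesses leads to a solution. -/
theorem ensures_searchCmd {M n ℓ : ℕ} {w : ℕ → ℕ} {s : RamState} (hs : RegsLE M s)
    (hn : n + n * n + 1 ≤ M) (hℓ : ℓ ≤ M) (hB : base n ℓ w ≤ M) (hB0 : 0 < base n ℓ w)
    (hN : guesses n ℓ w ≤ M)
    (hw : s.mem 0 = w) (hw0 : w 0 = n) (hw1 : w 1 = ℓ) (h1 : s.mem 1 = 0) (h2 : s.mem 2 = 0) :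
    searchCmd.Ensures M s fun s' =>
      s'.reg 0 ≠ 0 ↔ ∃ g < guesses n ℓ w, Succeeds n ℓ w (guess n ℓ w g) := by
  refine (ensures_sizesCmd hs hn hℓ hB hB0 hN hw hw0 hw1 h1 h2).seq ?_
  rintro s₁ ⟨hs₁, h0⟩
  refine (Ensures.forLoop (fun k s' => Ready M n ℓ w s' ∧
    (s'.reg 0 ≠ 0 ↔ ∃ g < k, Succeeds n ℓ w (guess n ℓ w g))) ?_ ?_ ?_).mono ?_
  · rwa [hs₁.reg4]
  · exact ⟨hs₁, by simp [h0]⟩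
  · rintro k hk s₂ ⟨hs₂, hk₂⟩
    rw [hs₁.reg4] at hk
    refine (ensures_guessCmd (g := k) (hs₂.regs.setReg 5 (by omega))
      (by simpa [RamState.reg_setReg] using hs₂.reg1)
      (by simpa [RamState.reg_setReg] using hs₂.reg3) hB0
      (by simp [RamState.reg_setReg])
      (by simpa [RamState.reg_setReg] using hs₂.reg6) hs₂.mem0 hs₂.mem2).frame.seq ?_
    rintro s₃ ⟨⟨hr₃, hg₃⟩, fr₃, fm₃⟩
    have m₃ : s₃.mem 0 = w := by simpa [hs₂.mem0] using fm₃ 0 (by simp [guessCmd, Stores])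
    have a₃ : ∀ r, r ∉ [5, 7, 18] → s₃.reg r = s₂.reg r := fun r hr => by
      rw [fr₃ r (by simp [guessCmd, Writes] at hr ⊢; omega), RamState.reg_setReg,
        if_neg (by simp at hr; omega)]
    refine (ensures_startCmd hr₃ ((a₃ 1 (by decide)).trans hs₂.reg1) m₃ ?_).frame.seq ?_
    · rw [fm₃ 1 (by simp [guessCmd, Stores])]
      exact hs₂.mem1
    rintro s₄ ⟨⟨hr₄, hx₄⟩, fr₄, fm₄⟩
    have m₄ : s₄.mem 0 = w := by simpa [m₃] using fm₄ 0 (by simp [startCmd, Stores])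
    have g₄ : s₄.mem 2 = guess n ℓ w k := by simpa [hg₃] using fm₄ 2 (by simp [startCmd, Stores])
    have a₄ : ∀ r, r ∉ [5, 7, 18, 8] → s₄.reg r = s₂.reg r := fun r hr => by
      rw [fr₄ r (by simp [startCmd, Writes] at hr ⊢; omega), a₃ r (by simp at hr ⊢; omega)]
    refine (ensures_sweeps hr₄ ((a₄ 1 (by decide)).trans hs₂.reg1)
      ((a₄ 17 (by decide)).trans hs₂.reg17) m₄ g₄ hx₄).frame.seq ?_
    rintro s₅ ⟨⟨hr₅, hx₅⟩, fr₅, fm₅⟩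
    have m₅ : s₅.mem 0 = w := by simpa [m₄] using fm₅ 0 (by simp [sweepCmd, Stores])
    have g₅ : s₅.mem 2 = guess n ℓ w k := by simpa [g₄] using fm₅ 2 (by simp [sweepCmd, Stores])
    have a₅ : ∀ r, r ∉ [5, 7, 18, 8, 9] → s₅.reg r = s₂.reg r := fun r hr => by
      rw [fr₅ r (by simp [sweepCmd, Writes] at hr ⊢; omega), a₄ r (by simp at hr ⊢; omega)]
    have r1 := (a₅ 1 (by decide)).trans hs₂.reg1
    have r2 := (a₅ 2 (by decide)).trans hs₂.reg2
    have r3 := (a₅ 3 (by decide)).trans hs₂.reg3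
    have r4 := (a₅ 4 (by decide)).trans hs₂.reg4
    have r6 := (a₅ 6 (by decide)).trans hs₂.reg6
    have r17 := (a₅ 17 (by decide)).trans hs₂.reg17
    have hrej : rejectsExpr.Holds s₅ ↔ ¬ Succeeds n ℓ w (guess n ℓ w k) := by
      rw [holds_rejectsExpr, r1, r2, m₅, g₅, hx₅, Succeeds, not_not]
    refine ensures_assign (by simp [RamExpr.Below, rejectsExpr_below])
      (by simp [VarBounded, rejectsExpr_varBounded]) hr₅ ⟨⟨hr₅.setReg _ ?_, ?_, ?_, ?_, ?_, ?_, ?_,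
      m₅, fun v hv => ?_, fun j hj => ?_⟩, ?_⟩
    · rw [eval_cond, eval_var, eval_lit]
      split
      · exact hr₅ 0 (by decide)
      · omega
    any_goals simpa [RamState.reg_setReg]
    · rw [RamState.mem_setReg, hx₅, sweeps_of_le _ _ _ hv]
    · rw [RamState.mem_setReg, g₅, guess, if_neg (by omega)]
    · rw [eval_cond, eval_var, eval_lit, a₅ 0 (by decide)]
      simp only [RamState.reg_setReg, if_true]
      -- A rejected guess keeps the answer and a successful one sets it to `1`, so register `0`
      -- accumulates a disjunction.
      simp only [Nat.lt_succ_iff_lt_or_eq, or_and_right, exists_or, exists_eq_left, ← hk₂]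
      by_cases h : Succeeds n ℓ w (guess n ℓ w k) <;> simp [hrej, h]
  · rintro s' ⟨-, h⟩
    rwa [hs₁.reg4] at h

end LayoutSearch

namespace LayoutSearch

/-! ### Guesses -/

theorem slotCount_mono (n : ℕ) (w : ℕ → ℕ) : Monotone (slotCount n w) := by
  classical
  exact fun i j h => Finset.card_le_card
    (Finset.filter_subset_filter _ (Finset.range_subset_range.2 h))

/-- Every assignment of digits to the relevant slots is among the guesses. -/
theorem exists_guess (n ℓ : ℕ) (w : ℕ → ℕ) (d : ℕ → ℕ)
    (hd : ∀ j < n + n * n, Slot n w j → d j < base n ℓ w) (hB : 0 < base n ℓ w) :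
    ∃ g < guesses n ℓ w, ∀ j < n + n * n, Slot n w j → guess n ℓ w g j = d j := by
  classical
  set B := base n ℓ w
  suffices H : ∀ m ≤ n + n * n, ∃ g < B ^ slotCount n w m, ∀ j < m, Slot n w j →
      g / B ^ slotCount n w j % B = d j by
    obtain ⟨g, hg, h⟩ := H _ le_rfl
    exact ⟨g, hg, fun j hj hs => by rw [guess, if_pos hj]; exact h j hj hs⟩
  intro m
  induction m with
  | zero => exact fun _ => ⟨0, by positivity, fun j hj => by omega⟩
  | succ m ih =>
    intro hm
    obtain ⟨g, hg, h⟩ := ih (by omega)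
    rw [slotCount_succ]
    by_cases hs : Slot n w m
    · have hdm := hd m (by omega) hs
      have hpos : 0 < B ^ slotCount n w m := by positivity
      -- The digit of slot `m` is put on top of the digits found so far.
      refine ⟨g + B ^ slotCount n w m * d m, ?_, fun j hj hj' => ?_⟩
      · rw [if_pos hs, pow_succ]
        nlinarith [Nat.mul_le_mul_left (B ^ slotCount n w m) (Nat.succ_le_of_lt hdm)]
      · rcases Nat.lt_succ_iff_lt_or_eq.1 hj with hlt | rfl
        · have h1 : slotCount n w j + 1 ≤ slotCount n w m := by
            have := slotCount_mono n w (Nat.succ_le_of_lt hlt)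
            rwa [Nat.succ_eq_add_one, slotCount_succ, if_pos hj'] at this
          obtain ⟨c, hc⟩ := Nat.exists_eq_add_of_le h1
          rw [hc, pow_add, pow_succ, mul_assoc, mul_assoc,
            Nat.add_mul_div_left _ _ (by positivity), Nat.add_mul_mod_self_left]
          exact h j hlt hj'
        · rw [Nat.add_mul_div_left _ _ hpos, Nat.div_eq_of_lt hg, zero_add, Nat.mod_eq_of_lt hdm]
    · refine ⟨g, by simpa [hs] using hg, fun j hj hj' => ?_⟩
      rcases Nat.lt_succ_iff_lt_or_eq.1 hj with hlt | rfl
      · exact h j hlt hj'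
      · exact absurd hj' hs

/-! ### The sweeps reach the least solution -/

theorem Left.mono {w D x y : ℕ → ℕ} {u v : ℕ} (h : Left w D x u v) (hu : y u ≤ x u)
    (hv : x v ≤ y v) : Left w D y u v := by
  unfold Left at *
  omega

theorem Left.irrefl (w D x : ℕ → ℕ) (u : ℕ) : ¬ Left w D x u u := by
  unfold Left
  omega

theorem Left.trans {w D x : ℕ → ℕ} {u v z : ℕ} (h : Left w D x u v) (h' : Left w D x v z) :
    Left w D x u z := by
  unfold Left at *
  omega

section Sweeps

variable {n : ℕ} {w D x y : ℕ → ℕ}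

/-- This is the Horn property. If `y v ≤ x v`, then passing from `x` to `y` moves `v` only to the
left and all other vertices only to the right, except that the endpoints of old edges do not move to
the right by `hold`. Every witness that `v` is too small is stable under such a move, so it would
also refute `y`. -/
theorem TooSmall.lt {v : ℕ} (h : TooSmall n w D x v) (hy : ¬ TooSmall n w D y v)
    (hxy : ∀ u < n, x u ≤ y u) (hold : ∀ a < n, ∀ b < n, 2 ≤ pcode n w a b → y a ≤ x a)
    (hsymm : ∀ a < n, ∀ b < n, pcode n w a b = pcode n w b a) : x v < y v := by
  by_contra hlt
  have hvy : y v ≤ x v := by omega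
  refine hy ?_
  rcases h with ⟨u, hu, h1, h2, h3, h4⟩ | ⟨u, hu, a, ha, b, hb, h1, h2, h3, h4, h5, h6⟩ |
    ⟨u, hu, a, ha, b, hb, h1, h2, h3, h4, h5, h6⟩
  · exact .inl ⟨u, hu, h1, h2, h3, h4.mono hvy (hxy u hu)⟩
  · exact .inr (.inl ⟨u, hu, a, ha, b, hb, h1, h2, h3, h4, h5.mono hvy (hxy a ha),
      -- `hold` speaks about the first end of an old edge, hence the symmetry of the codes.
      h6.mono (hold b hb a ha (by rw [hsymm b hb a ha]; omega)) (hxy u hu)⟩)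
  · exact .inr (.inr ⟨u, hu, a, ha, b, hb, h1, h2, h3, h4,
      h5.mono (hold a ha b hb (by omega)) (hxy u hu), h6.mono hvy (hxy b hb)⟩)

theorem le_raise (v u : ℕ) : x u ≤ raise n w D x v u := by
  unfold raise
  rw [Function.update_apply]
  split <;> simp_all

theorem le_sweep (k u : ℕ) : x u ≤ sweep n w D x k u := by
  induction k with
  | zero => rfl
  | succ k ih => exact ih.trans (le_raise _ _)

theorem start_le_sweeps (k u : ℕ) : start n w u ≤ sweeps n w D k u := by
  induction k with
  | zero => rfl
  | succ k ih => exact ih.trans (le_sweep _ _)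

/-- The sweep works in place, but as long as no vertex has been raised every test still refers to
`x`; and a single raise makes the sum grow for good. -/
theorem sweep_stable_or_sum_lt (k : ℕ) (hk : k ≤ n) :
    (sweep n w D x k = x ∧ ∀ v < k, ¬ TooSmall n w D x v) ∨
      ∑ v ∈ Finset.range n, x v < ∑ v ∈ Finset.range n, sweep n w D x k v := by
  induction k with
  | zero => exact .inl ⟨rfl, fun v hv => by omega⟩
  | succ k ih =>
    rcases ih (by omega) with ⟨h1, h2⟩ | h
    · by_cases hs : TooSmall n w D x k
      · refine .inr (Finset.sum_lt_sum (fun v _ => le_sweep _ _) ⟨k, by simp; omega, ?_⟩)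
        simp [sweep, raise, h1, hs]
      · refine .inl ⟨?_, fun v hv => ?_⟩
        · simp [sweep, raise, h1, hs]
        · rcases Nat.lt_succ_iff_lt_or_eq.1 hv with hlt | rfl
          · exact h2 v hlt
          · exact hs
    · exact .inr (h.trans_le (Finset.sum_le_sum fun v _ => le_raise _ _))

/-- Every sweep that changes something adds at least 1 to the sum of the positions. -/
theorem sweeps_stable_or_le_sum (k : ℕ) :
    (∀ v < n, ¬ TooSmall n w D (sweeps n w D k) v) ∨
      k ≤ ∑ v ∈ Finset.range n, sweeps n w D k v := by
  induction k with
  | zero => exact .inr (Nat.zero_le _)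
  | succ k ih =>
    rcases sweep_stable_or_sum_lt (n := n) (w := w) (D := D) (x := sweeps n w D k) n le_rfl with
      ⟨h1, h2⟩ | h
    · refine .inl ?_
      rw [sweeps, h1]
      exact h2
    · rcases ih with ih | ih
      · refine absurd h (not_lt.2 (le_of_eq ?_))
        -- A sweep does nothing in a stable state, so the sum cannot have grown.
        have : ∀ m ≤ n, sweep n w D (sweeps n w D k) m = sweeps n w D k := by
          intro m
          induction m with
          | zero => exact fun _ => rfl
          | succ m ihm =>
            intro hm
            rw [sweep, ihm (by omega), raise]
            simp [ih m (by omega)]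
        rw [this n le_rfl]
      · exact .inr (by rw [sweeps]; omega)

/-- A position is raised by 1 only while it is strictly below that of the solution `y`, by
`TooSmall.lt`; so every solution bounds the sweeps from above. -/
theorem sweeps_le (hy : ∀ v < n, ¬ TooSmall n w D y v)
    (hold : ∀ a < n, ∀ b < n, 2 ≤ pcode n w a b → y a ≤ vcode w a)
    (hsymm : ∀ a < n, ∀ b < n, pcode n w a b = pcode n w b a)
    (hstart : ∀ v < n, vcode w v ≤ y v) (k : ℕ) : ∀ v < n, sweeps n w D k v ≤ y v := by
  induction k with
  | zero =>
    intro v hv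
    rw [sweeps, start, if_pos hv]
    exact hstart v hv
  | succ k ih =>
    have : ∀ m ≤ n, ∀ v < n, sweep n w D (sweeps n w D k) m v ≤ y v := by
      intro m
      induction m with
      | zero => exact fun _ => ih
      | succ m ihm =>
        intro hm v hv
        rw [sweep, raise, Function.update_apply]
        split
        · next h =>
          subst h
          have h1 := ihm (by omega) v hv
          split
          · next hs =>
            refine hs.lt (hy v hv) (ihm (by omega)) (fun a ha b hb hab => ?_) hsymm
            -- Positions never drop below the initial ones, and these are the codes.
            refine (hold a ha b hb hab).trans (le_trans ?_ (le_sweep _ _))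
            simpa [start, ha] using start_le_sweeps (n := n) (w := w) (D := D) k a
          · exact h1
        · exact ihm (by omega) v hv
    exact this n le_rfl

/-- If there is a solution, then the sweeps end with positions that are large enough. -/
theorem sweeps_not_tooSmall (hy : ∀ v < n, ¬ TooSmall n w D y v)
    (hold : ∀ a < n, ∀ b < n, 2 ≤ pcode n w a b → y a ≤ vcode w a)
    (hsymm : ∀ a < n, ∀ b < n, pcode n w a b = pcode n w b a)
    (hstart : ∀ v < n, vcode w v ≤ y v) (hyn : ∀ v < n, y v ≤ n) :
    ∀ v < n, ¬ TooSmall n w D (sweeps n w D (n * n + 1)) v := by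
  -- Otherwise the sum would be at least `n * n + 1`, whereas `y` bounds it by `n * n`.
  refine (sweeps_stable_or_le_sum _).resolve_right fun h => ?_
  have h1 : ∑ v ∈ Finset.range n, sweeps n w D (n * n + 1) v ≤ ∑ v ∈ Finset.range n, n :=
    Finset.sum_le_sum fun v hv => (sweeps_le hy hold hsymm hstart _ v (Finset.mem_range.1 hv)).trans
      (hyn v (Finset.mem_range.1 hv))
  simp at h1
  omega

end Sweeps

end LayoutSearch

/-! ### The code of an instance -/

namespace QLEInstance

variable (I : QLEInstance)

theorem length_encode : I.encode.length = 2 + I.n + I.n * I.n := by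
  simp [encode, List.length_flatMap]
  omega

/-- The input word as a function. -/
noncomputable def word (j : ℕ) : ℕ := I.encode.getD j 0

theorem word_zero : I.word 0 = I.n := rfl

theorem word_one : I.word 1 = I.ℓ := rfl

theorem vcode_word (v : Fin I.n) : LayoutSearch.vcode I.word v = I.vertexCode v := by
  have h : (v : ℕ) < I.n := v.2
  rw [LayoutSearch.vcode, word, encode, List.append_assoc, List.getD_append_right _ _ _ _ (by simp)]
  simp [List.getD_eq_getElem?_getD, List.getElem?_append, h]

theorem _root_.List.getD_flatMap_of_length_eq {α β : Type*} (f : α → List β) (m : ℕ) (d : β)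
    (hf : ∀ a, (f a).length = m) (l : List α) (i j : ℕ) (hi : i < l.length) (hj : j < m) :
    (l.flatMap f).getD (i * m + j) d = (f l[i]).getD j d := by
  induction l generalizing i with
  | nil => simp at hi
  | cons a l ih =>
    rw [List.flatMap_cons]
    cases i with
    | zero => rw [List.getD_append _ _ _ _ (by rw [hf]; omega)]; simp
    | succ i =>
      have : (i + 1) * m + j = m + (i * m + j) := by ring
      rw [List.getD_append_right _ _ _ _ (by rw [hf]; omega), this, hf, Nat.add_sub_cancel_left,
        ih i (by simpa using hi)]
      rfl

theorem pcode_word (u v : Fin I.n) : LayoutSearch.pcode I.n I.word u v = I.pairCode u v := by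
  rw [LayoutSearch.pcode, word, encode, List.getD_append_right _ _ _ _ (by simp; omega)]
  have : 2 + I.n + ((u : ℕ) * I.n + v) - ([I.n, I.ℓ] ++
      List.map I.vertexCode (List.finRange I.n)).length = u * I.n + v := by
    simp
    omega
  rw [this, List.getD_flatMap_of_length_eq _ I.n 0 (by simp) _ _ _ (by simp) v.2]
  simp [List.getD_eq_getElem?_getD]

theorem vertexCode_eq_zero {v : Fin I.n} : I.vertexCode v = 0 ↔ v ∉ I.H.verts := by
  unfold vertexCode
  split <;> simp [*]

theorem pairCode_eq_one {u v : Fin I.n} : I.pairCode u v = 1 ↔ I.G.Adj u v ∧ ¬ I.H.Adj u v := by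
  unfold pairCode
  split
  · simp [*]
  · split <;> simp [*]

theorem pairCode_eq_add_two {u v : Fin I.n} {p : ℕ} : I.pairCode u v = p + 2 ↔
    ∃ h : I.H.Adj u v, (I.layout.page ⟨s(⟨u, I.H.edge_vert h⟩, ⟨v, I.H.edge_vert h.symm⟩), h⟩ : ℕ)
      = p := by
  unfold pairCode
  split
  · simp [*]
  · split <;> simp [*]

theorem pairCode_symm (u v : Fin I.n) : I.pairCode u v = I.pairCode v u := by
  unfold pairCode
  by_cases h : I.H.Adj u v
  · rw [dif_pos h, dif_pos h.symm]
    congr 3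
    exact Subtype.ext Sym2.eq_swap
  · rw [dif_neg h, dif_neg fun h' => h h'.symm]
    by_cases h' : I.G.Adj u v
    · rw [if_pos h', if_pos h'.symm]
    · rw [if_neg h', if_neg fun h'' => h' h''.symm]

theorem vertexCode_lt {u v : Fin I.n} (hu : u ∈ I.H.verts) (hv : v ∈ I.H.verts)
    (h : I.layout.prec ⟨u, hu⟩ ⟨v, hv⟩) : I.vertexCode u < I.vertexCode v := by
  have := I.layout.prec_strictTotalOrder
  unfold vertexCode
  rw [dif_pos hu, dif_pos hv]
  refine Nat.add_lt_add_right (Set.ncard_lt_ncard 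
    ⟨fun a (ha : I.layout.prec a _) => trans_of I.layout.prec ha h, fun hs => ?_⟩ (Set.toFinite _)) 1
  exact irrefl_of I.layout.prec _ (hs h)

theorem vertexCode_lt_iff {u v : Fin I.n} (hu : u ∈ I.H.verts) (hv : v ∈ I.H.verts) :
    I.vertexCode u < I.vertexCode v ↔ I.layout.prec ⟨u, hu⟩ ⟨v, hv⟩ := by
  have := I.layout.prec_strictTotalOrder
  refine ⟨fun h => ?_, I.vertexCode_lt hu hv⟩
  rcases trichotomous_of I.layout.prec ⟨u, hu⟩ ⟨v, hv⟩ with h' | h' | h'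
  · exact h'
  · cases h'
    omega
  · have := I.vertexCode_lt hv hu h'
    omega

theorem vertexCode_inj {u v : Fin I.n} (hu : u ∈ I.H.verts) (hv : v ∈ I.H.verts)
    (h : I.vertexCode u = I.vertexCode v) : u = v := by
  have := I.layout.prec_strictTotalOrder
  rcases trichotomous_of I.layout.prec ⟨u, hu⟩ ⟨v, hv⟩ with h' | h' | h'
  · have := I.vertexCode_lt hu hv h'
    omega
  · exact congrArg Subtype.val h'
  · have := I.vertexCode_lt hv hu h'
    omega

end QLEInstance

/-! ### Correctness -/

namespace QLEInstance

open LayoutSearch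

variable (I : QLEInstance)

theorem pcode_word_symm : ∀ a < I.n, ∀ b < I.n,
    pcode I.n I.word a b = pcode I.n I.word b a := by
  intro a ha b hb
  rw [I.pcode_word ⟨a, ha⟩ ⟨b, hb⟩, I.pcode_word ⟨b, hb⟩ ⟨a, ha⟩, I.pairCode_symm]

/-- `v` is missing or incident with a missing edge. -/
def IsSpecial (v : Fin I.n) : Prop := v ∉ I.H.verts ∨ ∃ u, I.G.Adj v u ∧ ¬ I.H.Adj v u

theorem special_word (v : Fin I.n) : Special I.n I.word v ↔ I.IsSpecial v := by
  rw [Special, IsSpecial, vcode_word, vertexCode_eq_zero]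
  refine or_congr Iff.rfl ⟨?_, ?_⟩
  · rintro ⟨u, hu, h⟩
    exact ⟨⟨u, hu⟩, I.pairCode_eq_one.1 ((I.pcode_word v ⟨u, hu⟩).symm.trans h)⟩
  · rintro ⟨u, h⟩
    exact ⟨u, u.2, (I.pcode_word v u).trans (I.pairCode_eq_one.2 h)⟩

/-- A guess and positions that are not rejected describe a queue layout. -/
theorem isYes_of_not_rejects (D x : ℕ → ℕ) (h : ¬ Rejects I.n I.ℓ I.word D x) : I.IsYes := by
  simp only [Rejects, TooSmall, not_or, not_exists, not_and] at h
  obtain ⟨hinj, hpage, hnew, htoo, hpos⟩ := h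
  replace hinj : ∀ u v : Fin I.n, I.IsSpecial u → I.IsSpecial v → D u = D v → u = v := by
    intro u v hu hv huv
    by_contra hne
    exact hinj u u.2 v v.2 ((I.special_word u).2 hu) ((I.special_word v).2 hv)
      (fun h => hne (Fin.ext h)) huv
  replace hpage : ∀ u v : Fin I.n, I.G.Adj u v → ¬ I.H.Adj u v → gpage I.n D u v < I.ℓ :=
    fun u v h h' => not_le.1 (hpage u u.2 v v.2
      ((I.pcode_word u v).trans (I.pairCode_eq_one.2 ⟨h, h'⟩)))
  replace hpos : ∀ v : Fin I.n, v ∈ I.H.verts → x v = I.vertexCode v := by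
    intro v hv
    by_contra hne
    rw [← I.vcode_word v] at hne
    exact hpos v v.2 (by rw [vcode_word]; exact fun h => I.vertexCode_eq_zero.1 h hv) hne
  -- On special vertices the spine order agrees with the guessed ranks: the ranks are distinct, and
  -- the first clause of `TooSmall` excludes an inversion.
  have hmono : ∀ u v : Fin I.n, I.IsSpecial u → I.IsSpecial v → Left I.word D x u v →
      D u < D v := by
    intro u v hu hv huv
    rcases lt_trichotomy (D u) (D v) with h | h | h
    · exact h
    · have := hinj u v hu hv h
      subst this
      exact absurd huv (Left.irrefl _ _ _ _)
    · exact absurd huv ((htoo u u.2).1 v v.2 ((I.special_word v).2 hv) ((I.special_word u).2 hu) h)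
  -- Incomparable vertices have equal positions and equal ties. Two old ones then have the same
  -- code, two missing ones the same rank, and an old vertex has tie `0` while a missing one has a
  -- positive tie.
  have htotal : ∀ u v : Fin I.n, Left I.word D x u v ∨ u = v ∨ Left I.word D x v u := by
    intro u v
    by_contra hne
    simp only [not_or] at hne
    obtain ⟨h1, h2, h3⟩ := hne
    have hx : x u = x v := by unfold Left at h1 h3; omega
    have ht : tie I.word D u = tie I.word D v := by unfold Left at h1 h3; omega
    unfold tie at ht
    rw [vcode_word, vcode_word] at ht
    by_cases hu : u ∈ I.H.verts <;> by_cases hv : v ∈ I.H.verts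
    · exact h2 (I.vertexCode_inj hu hv (by rw [← hpos u hu, ← hpos v hv, hx]))
    · rw [if_neg (fun h => I.vertexCode_eq_zero.1 h hu), if_pos (I.vertexCode_eq_zero.2 hv)] at ht
      omega
    · rw [if_neg (fun h => I.vertexCode_eq_zero.1 h hv), if_pos (I.vertexCode_eq_zero.2 hu)] at ht
      omega
    · rw [if_pos (I.vertexCode_eq_zero.2 hv), if_pos (I.vertexCode_eq_zero.2 hu)] at ht
      exact h2 (hinj u v (.inl hu) (.inl hv) (by omega))
  have hold : ∀ u v : Fin I.n, u ∈ I.H.verts → v ∈ I.H.verts →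
      (Left I.word D x u v ↔ I.vertexCode u < I.vertexCode v) := by
    intro u v hu hv
    unfold Left tie
    rw [vcode_word, vcode_word, if_neg (fun h => I.vertexCode_eq_zero.1 h hu),
      if_neg (fun h => I.vertexCode_eq_zero.1 h hv), hpos u hu, hpos v hv]
    simp
  -- A missing edge has two slots, one for each orientation; its page is read from the one in which
  -- the rank increases.
  have hex : ∀ e : I.G.edgeSet, ∃ p : Fin I.ℓ, ∀ u v : Fin I.n, e.1 = s(u, v) →
      (I.H.Adj u v → I.pairCode u v = p + 2) ∧
      (¬ I.H.Adj u v → D u < D v → gpage I.n D u v = p) := by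
    rintro ⟨e, he⟩
    induction e using Sym2.ind with
    | _ a b =>
    by_cases hH : I.H.Adj a b
    · obtain ⟨p, hp⟩ : ∃ p : Fin I.ℓ, I.pairCode a b = p + 2 :=
        ⟨_, I.pairCode_eq_add_two.2 ⟨hH, rfl⟩⟩
      refine ⟨p, fun u v huv => ?_⟩
      rcases Sym2.eq_iff.1 huv with ⟨rfl, rfl⟩ | ⟨rfl, rfl⟩
      · exact ⟨fun _ => hp, fun h => absurd hH h⟩
      · exact ⟨fun _ => by rw [I.pairCode_symm, hp], fun h => absurd hH.symm h⟩
    · have hH' : ¬ I.H.Adj b a := fun h => hH h.symm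
      rcases lt_or_ge (D a) (D b) with hlt | hle
      · refine ⟨⟨gpage I.n D a b, hpage a b he hH⟩, fun u v huv => ?_⟩
        rcases Sym2.eq_iff.1 huv with ⟨rfl, rfl⟩ | ⟨rfl, rfl⟩
        · exact ⟨fun h => absurd h hH, fun _ _ => rfl⟩
        · exact ⟨fun h => absurd h hH', fun _ _ => by omega⟩
      · refine ⟨⟨gpage I.n D b a, hpage b a (show I.G.Adj a b from he).symm hH'⟩, fun u v huv => ?_⟩
        rcases Sym2.eq_iff.1 huv with ⟨rfl, rfl⟩ | ⟨rfl, rfl⟩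
        · exact ⟨fun h => absurd h hH, fun _ _ => by omega⟩
        · exact ⟨fun h => absurd h hH', fun _ _ => rfl⟩
  choose page hpg using hex
  have hspec : ∀ u v : Fin I.n, I.G.Adj u v → ¬ I.H.Adj u v → I.IsSpecial u ∧ I.IsSpecial v :=
    fun u v h h' => ⟨.inr ⟨v, h, h'⟩, .inr ⟨u, h.symm, fun h'' => h' h''.symm⟩⟩
  refine ⟨⟨fun u v => Left I.word D x u v, page, ?_, ?_⟩, ?_, ?_⟩
  · exact { trichotomous := fun u v h h' => ((htotal u v).resolve_left h).resolve_right h'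
            irrefl := fun u => Left.irrefl _ _ _ _
            trans := fun u v z => Left.trans }
  · rintro u₁ v₁ u₂ v₂ h₁ h₂ heq ⟨n1, n2, n3⟩
    have l₁ : Left I.word D x u₁ v₁ := (n1.trans n2).trans n3
    -- Two old edges do not nest in the given layout. An old edge around a missing one is excluded
    -- by the third clause of `TooSmall`, a missing edge around an old one by the second, and two
    -- missing edges by the third test of `Rejects`.
    by_cases hH₁ : I.H.Adj u₁ v₁ <;> by_cases hH₂ : I.H.Adj u₂ v₂
    · have e₁ := (hpg ⟨s(u₁, v₁), h₁⟩ u₁ v₁ rfl).1 hH₁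
      have e₂ := (hpg ⟨s(u₂, v₂), h₂⟩ u₂ v₂ rfl).1 hH₂
      obtain ⟨a₁, e₁⟩ := I.pairCode_eq_add_two.1 e₁
      obtain ⟨a₂, e₂⟩ := I.pairCode_eq_add_two.1 e₂
      have w₁ := I.H.edge_vert hH₁
      have w₂ := I.H.edge_vert hH₂
      have w₃ := I.H.edge_vert hH₁.symm
      have w₄ := I.H.edge_vert hH₂.symm
      refine I.layout.not_nests ⟨u₁, w₁⟩ ⟨v₁, w₃⟩ ⟨u₂, w₂⟩ ⟨v₂, w₄⟩ a₁ a₂ ?_ ⟨?_, ?_, ?_⟩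
      · exact Fin.ext (by rw [e₁, e₂, heq])
      · exact (I.vertexCode_lt_iff _ _).1 ((hold _ _ w₁ w₂).1 n1)
      · exact (I.vertexCode_lt_iff _ _).1 ((hold _ _ w₂ w₄).1 n2)
      · exact (I.vertexCode_lt_iff _ _).1 ((hold _ _ w₄ w₃).1 n3)
    · have e₁ := (hpg ⟨s(u₁, v₁), h₁⟩ u₁ v₁ rfl).1 hH₁
      obtain ⟨s₂, s₂'⟩ := hspec _ _ h₂ hH₂
      have hD := hmono _ _ s₂ s₂' n2
      have e₂ := (hpg ⟨s(u₂, v₂), h₂⟩ u₂ v₂ rfl).2 hH₂ hD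
      refine (htoo v₂ v₂.2).2.2 u₂ u₂.2 u₁ u₁.2 v₁ v₁.2 ?_ hD ?_ ?_ n1 n3
      · exact (I.pcode_word _ _).trans (I.pairCode_eq_one.2 ⟨h₂, hH₂⟩)
      · rw [I.pcode_word, e₁, e₂, heq]
      · rw [vcode_word, vcode_word]
        exact (hold _ _ (I.H.edge_vert hH₁) (I.H.edge_vert hH₁.symm)).1 l₁
    · have e₂ := (hpg ⟨s(u₂, v₂), h₂⟩ u₂ v₂ rfl).1 hH₂
      obtain ⟨s₁, s₁'⟩ := hspec _ _ h₁ hH₁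
      have hD := hmono _ _ s₁ s₁' l₁
      have e₁ := (hpg ⟨s(u₁, v₁), h₁⟩ u₁ v₁ rfl).2 hH₁ hD
      refine (htoo u₁ u₁.2).2.1 v₁ v₁.2 u₂ u₂.2 v₂ v₂.2 ?_ hD ?_ ?_ n1 n3
      · exact (I.pcode_word _ _).trans (I.pairCode_eq_one.2 ⟨h₁, hH₁⟩)
      · rw [I.pcode_word, e₁, e₂, heq]
      · rw [vcode_word, vcode_word]
        exact (hold _ _ (I.H.edge_vert hH₂) (I.H.edge_vert hH₂.symm)).1 n2
    · obtain ⟨s₁, s₁'⟩ := hspec _ _ h₁ hH₁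
      obtain ⟨s₂, s₂'⟩ := hspec _ _ h₂ hH₂
      have e₁ := (hpg ⟨s(u₁, v₁), h₁⟩ u₁ v₁ rfl).2 hH₁ (hmono _ _ s₁ s₁' l₁)
      have e₂ := (hpg ⟨s(u₂, v₂), h₂⟩ u₂ v₂ rfl).2 hH₂ (hmono _ _ s₂ s₂' n2)
      exact hnew u₁ u₁.2 v₁ v₁.2 u₂ u₂.2 v₂ v₂.2
        ((I.pcode_word _ _).trans (I.pairCode_eq_one.2 ⟨h₁, hH₁⟩))
        ((I.pcode_word _ _).trans (I.pairCode_eq_one.2 ⟨h₂, hH₂⟩)) (by rw [e₁, e₂, heq])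
        (hmono _ _ s₁ s₂ n1) (hmono _ _ s₂ s₂' n2) (hmono _ _ s₂' s₁' n3)
  · intro u v
    exact ((hold u v u.2 v.2).trans (I.vertexCode_lt_iff u.2 v.2)).symm
  · intro u v h
    have e := (hpg ⟨s((u : Fin I.n), (v : Fin I.n)), I.H.adj_sub h⟩ u v rfl).1 h
    obtain ⟨_, e'⟩ := I.pairCode_eq_add_two.1 e
    exact Fin.ext e'.symm

/-- The number of special vertices is at most the number of slots. -/
theorem ncard_isSpecial_le : {v | I.IsSpecial v}.ncard ≤ slotCount I.n I.word (I.n + I.n * I.n) := by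
  classical
  rw [slotCount, Set.ncard_eq_toFinset_card', ← Finset.card_map Fin.valEmbedding]
  refine Finset.card_le_card fun j hj => ?_
  simp only [Finset.mem_map, Set.mem_toFinset, Set.mem_ofPred_eq, Fin.valEmbedding_apply] at hj
  obtain ⟨v, hv, rfl⟩ := hj
  have := v.2
  simp only [Finset.mem_filter, Finset.mem_range]
  exact ⟨by omega, .inl ⟨this, (I.special_word v).2 hv⟩⟩

/-- A queue layout that extends the given one leads to a guess with which the search succeeds. -/
theorem exists_guess_of_isYes (h : I.IsYes) : ∃ g < guesses I.n I.ℓ I.word,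
    Succeeds I.n I.ℓ I.word (guess I.n I.ℓ I.word g) := by
  classical
  obtain ⟨L, hprec, hpage⟩ := h
  have := L.prec_strictTotalOrder
  have hℓ := I.one_le_ℓ
  -- Counting special vertices only keeps the rank below the base of the digits.
  let rank (v : Fin I.n) : ℕ := {u | I.IsSpecial u ∧ L.prec u v}.ncard
  let pg (u v : Fin I.n) : ℕ := if h : I.G.Adj u v then L.page ⟨s(u, v), h⟩ else 0
  have hrank : ∀ u v, I.IsSpecial u → L.prec u v → rank u < rank v := by
    intro u v hu huv
    refine Set.ncard_lt_ncard ⟨fun a ha => ⟨ha.1, trans_of L.prec ha.2 huv⟩, fun hs => ?_⟩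
      (Set.toFinite _)
    exact irrefl_of L.prec _ (hs ⟨hu, huv⟩).2
  have hB : 0 < base I.n I.ℓ I.word := by unfold base; omega
  -- Slots below `n` belong to vertices, and slot `n + (u * n + v)` belongs to the pair `u, v`,
  -- recovered by division with remainder.
  let d (j : ℕ) : ℕ := if hj : j < I.n then rank ⟨j, hj⟩ else
    if hj : (j - I.n) / I.n < I.n ∧ (j - I.n) % I.n < I.n then pg ⟨_, hj.1⟩ ⟨_, hj.2⟩ else 0
  have hd : ∀ j < I.n + I.n * I.n, Slot I.n I.word j → d j < base I.n I.ℓ I.word := by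
    intro j hj hs
    dsimp only [d]
    split
    · refine lt_of_le_of_lt (le_trans (Set.ncard_le_ncard (fun u hu => hu.1) (Set.toFinite _))
        I.ncard_isSpecial_le) ?_
      unfold base
      omega
    · split
      · dsimp only [pg]
        split
        · refine (Fin.is_lt _).trans_le ?_
          unfold base
          omega
        · exact hB
      · exact hB
  obtain ⟨g, hg, hgd⟩ := exists_guess I.n I.ℓ I.word d hd hB
  refine ⟨g, hg, ?_⟩
  set D := guess I.n I.ℓ I.word g
  have hD : ∀ v : Fin I.n, I.IsSpecial v → D v = rank v := by
    intro v hv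
    have hv' := v.2
    rw [hgd v (by omega) (.inl ⟨hv', (I.special_word v).2 hv⟩)]
    simp [d]
  have hDp : ∀ u v : Fin I.n, I.pairCode u v = 1 → ∃ h : I.G.Adj u v,
      gpage I.n D u v = L.page ⟨s(u, v), h⟩ := by
    intro u v huv
    have hlt : (u : ℕ) * I.n + v < I.n * I.n := by
      have := Nat.mul_le_mul_right I.n (Nat.succ_le_of_lt u.2)
      have := v.2
      rw [Nat.succ_mul] at *
      omega
    refine ⟨(I.pairCode_eq_one.1 huv).1, ?_⟩
    have hw : I.word (2 + (I.n + (u * I.n + v))) = 1 := by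
      rw [← huv, ← I.pcode_word, pcode, add_assoc 2]
    rw [gpage, hgd _ (by omega) (.inr ⟨by omega, hw⟩)]
    have hn : 0 < I.n := u.pos
    have h1 : ((u : ℕ) * I.n + v) / I.n = u := by
      rw [mul_comm, Nat.mul_add_div hn, Nat.div_eq_of_lt v.2, add_zero]
    have h2 : ((u : ℕ) * I.n + v) % I.n = v := by
      rw [mul_comm, Nat.mul_add_mod, Nat.mod_eq_of_lt v.2]
    simp [d, h1, h2, pg, (I.pairCode_eq_one.1 huv).1]
  -- An old vertex counts itself, so that its position equals its code, which is one more than the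
  -- number of old vertices to its left.
  let pos (v : Fin I.n) : ℕ := {u | u ∈ I.H.verts ∧ (u = v ∨ L.prec u v)}.ncard
  let y (j : ℕ) : ℕ := if hj : j < I.n then pos ⟨j, hj⟩ else 0
  have hy : ∀ v : Fin I.n, y v = pos v := fun v => by simp [y]
  have hyold : ∀ v : Fin I.n, v ∈ I.H.verts → y v = I.vertexCode v := by
    intro v hv
    rw [hy, vertexCode, dif_pos hv]
    have h1 : {u | u ∈ I.H.verts ∧ (u = v ∨ L.prec u v)} =
        insert v (Subtype.val '' {u : I.H.verts | I.layout.prec u ⟨v, hv⟩}) := by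
      ext u
      simp only [Set.mem_ofPred_eq, Set.mem_insert_iff, Set.mem_image, Subtype.exists,
        exists_and_right, exists_eq_right, hprec]
      constructor
      · rintro ⟨h1, h2 | h2⟩
        · exact .inl h2
        · exact .inr ⟨h1, h2⟩
      · rintro (h2 | ⟨h1, h2⟩)
        · exact ⟨h2 ▸ hv, .inl h2⟩
        · exact ⟨h1, .inr h2⟩
    have h2 : v ∉ Subtype.val '' {u : I.H.verts | I.layout.prec u ⟨v, hv⟩} := by
      rintro ⟨u, hu, rfl⟩
      exact irrefl_of L.prec _ ((hprec _ _).1 hu)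
    change Set.ncard _ = _
    rw [h1, Set.ncard_insert_of_notMem h2 (Set.toFinite _),
      Set.ncard_image_of_injective _ Subtype.val_injective]
  have hsub : ∀ u v, L.prec u v → {z | z ∈ I.H.verts ∧ (z = u ∨ L.prec z u)} ⊆
      {z | z ∈ I.H.verts ∧ (z = v ∨ L.prec z v)} := by
    rintro u v huv z ⟨hz, rfl | h⟩
    · exact ⟨hz, .inr huv⟩
    · exact ⟨hz, .inr (trans_of L.prec h huv)⟩
  have hleft : ∀ u v, L.prec u v → Left I.word D y u v := by
    intro u v huv
    rcases (Set.ncard_le_ncard (hsub u v huv) (Set.toFinite _)).lt_or_eq with h | h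
    · exact .inl (by rw [hy, hy]; exact h)
    -- Equal positions mean that no old vertex lies after `u` up to and including `v`. Hence `v` is
    -- missing, and the ties decide in favour of `u`.
    · have heq := Set.eq_of_subset_of_ncard_le (hsub u v huv) h.ge (Set.toFinite _)
      have hv : v ∉ I.H.verts := by
        intro hv
        obtain ⟨-, h | h⟩ : v ∈ {z | z ∈ I.H.verts ∧ (z = u ∨ L.prec z u)} :=
          heq ▸ ⟨hv, .inl rfl⟩
        · exact irrefl_of L.prec _ (h ▸ huv)
        · exact asymm_of L.prec h huv
      refine .inr ⟨by rw [hy, hy]; exact h, ?_⟩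
      unfold tie
      rw [vcode_word, vcode_word, if_pos (I.vertexCode_eq_zero.2 hv)]
      split
      · next hu =>
        have hu := I.vertexCode_eq_zero.1 hu
        rw [hD u (.inl hu), hD v (.inl hv)]
        have := hrank u v (.inl hu) huv
        omega
      · omega
  have hleft' : ∀ u v : Fin I.n, Left I.word D y u v → L.prec u v := by
    intro u v huv
    rcases trichotomous_of L.prec u v with h | h | h
    · exact h
    · subst h
      exact absurd huv (Left.irrefl _ _ _ _)
    · exact absurd (huv.trans (hleft v u h)) (Left.irrefl _ _ _ _)
  have hDprec : ∀ u v : Fin I.n, I.IsSpecial u → I.IsSpecial v → D u < D v → L.prec u v := by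
    intro u v hu hv huv
    rw [hD u hu, hD v hv] at huv
    rcases trichotomous_of L.prec u v with h | h | h
    · exact h
    · subst h
      omega
    · have := hrank v u hv h
      omega
  have hspec : ∀ u v : Fin I.n, I.pairCode u v = 1 → I.IsSpecial u ∧ I.IsSpecial v := by
    intro u v h
    obtain ⟨h, h'⟩ := I.pairCode_eq_one.1 h
    exact ⟨.inr ⟨v, h, h'⟩, .inr ⟨u, h.symm, fun h'' => h' h''.symm⟩⟩
  have hH : ∀ a b : Fin I.n, ∀ p, I.pairCode a b = p + 2 → I.vertexCode a < I.vertexCode b →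
      L.prec a b ∧ ∃ h : I.G.Adj a b, (L.page ⟨s(a, b), h⟩ : ℕ) = p := by
    intro a b p hp hab
    obtain ⟨h, hp⟩ := I.pairCode_eq_add_two.1 hp
    have e := hpage ⟨a, I.H.edge_vert h⟩ ⟨b, I.H.edge_vert h.symm⟩ h
    exact ⟨(hprec _ _).1 ((I.vertexCode_lt_iff (I.H.edge_vert h) (I.H.edge_vert h.symm)).1 hab),
      I.H.adj_sub h, by rw [e, hp]⟩
  have hytoo : ∀ v < I.n, ¬ TooSmall I.n I.word D y v := by
    intro v hv
    lift v to Fin I.n using hv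
    rintro (⟨u, hu, h1, h2, h3, h4⟩ | ⟨u, hu, a, ha, b, hb, h1, h2, h3, h4, h5, h6⟩ |
      ⟨u, hu, a, ha, b, hb, h1, h2, h3, h4, h5, h6⟩)
    · lift u to Fin I.n using hu
      rw [special_word] at h1 h2
      exact asymm_of L.prec (hleft' _ _ h4) (hDprec _ _ h1 h2 h3)
    all_goals
      lift u to Fin I.n using hu
      lift a to Fin I.n using ha
      lift b to Fin I.n using hb
      rw [pcode_word] at h1 h3
      rw [vcode_word, vcode_word] at h4
      obtain ⟨q1, e1, q2⟩ := hH a b _ h3 h4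
      obtain ⟨e2, q3⟩ := hDp _ _ h1
      have hs := hspec _ _ h1
    · exact L.not_nests v u a b e2 e1 (Fin.ext (by rw [q2, q3])) ⟨hleft' _ _ h5, q1, hleft' _ _ h6⟩
    · exact L.not_nests a b u v e1 e2 (Fin.ext (by rw [q2, q3]))
        ⟨hleft' _ _ h5, hDprec _ _ hs.1 hs.2 h2, hleft' _ _ h6⟩
  have hstart : ∀ v < I.n, vcode I.word v ≤ y v := by
    intro v hv
    lift v to Fin I.n using hv
    rw [vcode_word]
    by_cases h : v ∈ I.H.verts
    · exact (hyold v h).ge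
    · rw [I.vertexCode_eq_zero.2 h]
      exact Nat.zero_le _
  have hold : ∀ a < I.n, ∀ b < I.n, 2 ≤ pcode I.n I.word a b → y a ≤ vcode I.word a := by
    intro a ha b hb hab
    lift a to Fin I.n using ha
    lift b to Fin I.n using hb
    rw [pcode_word] at hab
    obtain ⟨p, hp⟩ := Nat.exists_eq_add_of_le' hab
    obtain ⟨h, -⟩ := I.pairCode_eq_add_two.1 hp
    rw [vcode_word, hyold a (I.H.edge_vert h)]
  have hyn : ∀ v < I.n, y v ≤ I.n := by
    intro v hv
    lift v to Fin I.n using hv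
    rw [hy]
    exact (Set.ncard_le_card _).trans (by simp)
  rintro (⟨u, hu, v, hv, h1, h2, h3, h4⟩ | ⟨u, hu, v, hv, h1, h2⟩ |
    ⟨u, hu, v, hv, a, ha, b, hb, h1, h2, h3, h4, h5, h6⟩ | ⟨v, hv, h⟩ | ⟨v, hv, h1, h2⟩)
  · lift u to Fin I.n using hu
    lift v to Fin I.n using hv
    rw [special_word] at h1 h2
    rw [hD u h1, hD v h2] at h4
    rcases trichotomous_of L.prec u v with h | h | h
    · exact (hrank u v h1 h).ne h4
    · exact h3 (congrArg _ h)
    · exact (hrank v u h2 h).ne' h4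
  · lift u to Fin I.n using hu
    lift v to Fin I.n using hv
    rw [pcode_word] at h1
    obtain ⟨e, he⟩ := hDp u v h1
    rw [he] at h2
    exact absurd h2 (not_le.2 (Fin.is_lt _))
  · lift u to Fin I.n using hu
    lift v to Fin I.n using hv
    lift a to Fin I.n using ha
    lift b to Fin I.n using hb
    rw [pcode_word] at h1 h2
    obtain ⟨e1, q1⟩ := hDp _ _ h1
    obtain ⟨e2, q2⟩ := hDp _ _ h2
    have s1 := hspec _ _ h1
    have s2 := hspec _ _ h2
    exact L.not_nests u v a b e1 e2 (Fin.ext (by rw [← q1, ← q2, h3]))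
      ⟨hDprec _ _ s1.1 s2.1 h4, hDprec _ _ s2.1 s2.2 h5, hDprec _ _ s2.2 s1.2 h6⟩
  · exact sweeps_not_tooSmall hytoo hold I.pcode_word_symm hstart hyn v hv h
  -- An old vertex starts at its code, and the positions `y` of the solution, which also equal the
  -- code there, keep it from being raised.
  · refine h2 (le_antisymm ?_ ?_)
    · refine (sweeps_le hytoo hold I.pcode_word_symm hstart _ v hv).trans ?_
      lift v to Fin I.n using hv
      rw [vcode_word] at h1 ⊢
      exact (hyold v (by by_contra h; exact h1 (I.vertexCode_eq_zero.2 h))).le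
    · simpa [start, hv] using start_le_sweeps (n := I.n) (w := I.word) (D := D) (I.n * I.n + 1) v

end QLEInstance

/-! ### Bounds in terms of the parameter -/

namespace QLEInstance

open LayoutSearch

variable (I : QLEInstance)

/-- The number of ordered pairs that are missing edges. -/
theorem ncard_pairCode_eq_one_le :
    {p : Fin I.n × Fin I.n | I.pairCode p.1 p.2 = 1}.ncard ≤
      2 * (I.G.edgeSet \ I.H.edgeSet).ncard := by
  classical
  rw [Set.ncard_eq_toFinset_card', Set.ncard_eq_toFinset_card']
  -- Each missing edge comes from at most two ordered pairs.
  refine (Finset.card_le_mul_card_image (f := fun p => s(p.1, p.2)) _ 2 fun e he => ?_).trans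
    (Nat.mul_le_mul_left 2 (Finset.card_le_card fun e he => ?_))
  · induction e using Sym2.ind with
    | _ a b =>
    refine (Finset.card_le_card (t := {(a, b), (b, a)}) fun p hp => ?_).trans Finset.card_le_two
    have := (Finset.mem_filter.1 hp).2
    rcases Sym2.eq_iff.1 this with ⟨h1, h2⟩ | ⟨h1, h2⟩ <;> simp [Prod.ext_iff, h1, h2]
  · obtain ⟨p, hp, rfl⟩ := Finset.mem_image.1 he
    rw [Set.mem_toFinset] at hp ⊢
    exact I.pairCode_eq_one.1 hp

/-- A missing edge gives two ordered pairs, and each pair accounts for at most one special vertex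
and one page slot. With the missing vertices this makes at most one slot per missing vertex and four
per missing edge. -/
theorem slotCount_le : slotCount I.n I.word (I.n + I.n * I.n) ≤ 4 * I.missing := by
  classical
  set P := {p : Fin I.n × Fin I.n | I.pairCode p.1 p.2 = 1}
  have hP : P.ncard ≤ _ := I.ncard_pairCode_eq_one_le
  have hS : {v | I.IsSpecial v}.ncard ≤ (I.H.vertsᶜ).ncard + P.ncard := by
    refine (Set.ncard_le_ncard (t := I.H.vertsᶜ ∪ Prod.fst '' P) ?_ (Set.toFinite _)).trans
      ((Set.ncard_union_le _ _).trans (Nat.add_le_add_left (Set.ncard_image_le (Set.toFinite _)) _))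
    rintro v (hv | ⟨u, hu⟩)
    · exact .inl hv
    · exact .inr ⟨(v, u), I.pairCode_eq_one.2 hu, rfl⟩
  have hsub : slotCount I.n I.word (I.n + I.n * I.n) ≤ {v | I.IsSpecial v}.ncard + P.ncard := by
    rw [slotCount, ← Set.ncard_coe_finset]
    refine (Set.ncard_le_ncard (t := (fun v : Fin I.n => (v : ℕ)) '' {v | I.IsSpecial v} ∪
      (fun p : Fin I.n × Fin I.n => I.n + ((p.1 : ℕ) * I.n + p.2)) '' P) ?_ (Set.toFinite _)).trans
      ((Set.ncard_union_le _ _).trans (Nat.add_le_add (Set.ncard_image_le (Set.toFinite _))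
        (Set.ncard_image_le (Set.toFinite _))))
    intro j hj
    simp only [Finset.coe_filter, Finset.mem_range] at hj
    obtain ⟨hlt, ⟨h1, h2⟩ | ⟨h1, h2⟩⟩ := hj
    · exact .inl ⟨⟨j, h1⟩, (I.special_word ⟨j, h1⟩).1 h2, rfl⟩
    · have hn : 0 < I.n := by
        by_contra h0
        have : I.n = 0 := by omega
        simp [this] at hlt
      have e1 : (j - I.n) / I.n < I.n := by
        rw [Nat.div_lt_iff_lt_mul hn]
        omega
      have e2 : (j - I.n) % I.n < I.n := Nat.mod_lt _ hn
      have e3 : I.n + ((j - I.n) / I.n * I.n + (j - I.n) % I.n) = j := by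
        rw [Nat.div_add_mod']
        omega
      refine .inr ⟨(⟨_, e1⟩, ⟨_, e2⟩), ?_, e3⟩
      change I.pairCode _ _ = 1
      rw [← I.pcode_word, pcode, add_assoc 2]
      exact (congrArg (fun i => I.word (2 + i)) e3).trans h2
  unfold missing
  omega

theorem isYes_iff : I.IsYes ↔ ∃ g < guesses I.n I.ℓ I.word,
    Succeeds I.n I.ℓ I.word (guess I.n I.ℓ I.word g) :=
  ⟨I.exists_guess_of_isYes, fun ⟨_, _, h⟩ => I.isYes_of_not_rejects _ _ h⟩

end QLEInstance

/-- A bound on the number of guesses in terms of the parameter. -/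
def guessBound (k : ℕ) : ℕ := (5 * k) ^ (4 * k) + 5 * k + 6

theorem computable_guessBound_pow (w : ℕ) : Computable fun k => guessBound k ^ w := by
  have hpow : Primrec₂ fun a b : ℕ => a ^ b := Primrec₂.unpaired'.1 Nat.Primrec.pow
  have hmul (c : ℕ) : Primrec fun k : ℕ => c * k :=
    Primrec.nat_mul.comp (Primrec.const c) Primrec.id
  have h1 : Primrec guessBound :=
    Primrec.nat_add.comp (Primrec.nat_add.comp (hpow.comp (hmul 5) (hmul 4)) (hmul 5))
      (Primrec.const 6)
  exact (hpow.comp h1 (Primrec.const w)).to_comp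

theorem mainTheorem1 :
    FixedParameterTractable QLEInstance.encode QLEInstance.size
      (fun I : QLEInstance => I.ℓ + I.missing) QLEInstance.IsYes := by
  obtain ⟨w, hw⟩ := LayoutSearch.searchCmd.runs_compile
  -- The command uses the registers below 19, so the scratch area starts there. The exponent is `2 *
  -- w` because the loop bound `M` is quadratic in the size.
  refine ⟨LayoutSearch.searchCmd.compile 19, fun k => guessBound k ^ w, 2 * w,
    computable_guessBound_pow w, fun I => ?_⟩
  set k := I.ℓ + I.missing with hk
  have hℓ := I.one_le_ℓ
  have hslot := I.slotCount_le
  have hS : I.n + I.ℓ ≤ I.size := by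
    unfold QLEInstance.size
    omega
  have hS2 : I.n + I.n * I.n + 2 ≤ 4 * I.size ^ 2 := by nlinarith
  have hS1 : 1 ≤ I.size ^ 2 := Nat.one_le_pow _ _ (by omega)
  -- The summands dominate the number of guesses, the base, and the factor 4 in `hS2`, so that `A *
  -- I.size ^ 2` bounds all registers.
  set A := (5 * k) ^ (4 * k) + 5 * k + 4 with hA
  have hAM : A ≤ A * I.size ^ 2 := Nat.le_mul_of_pos_right _ hS1
  have h4 : 4 * I.size ^ 2 ≤ A * I.size ^ 2 := Nat.mul_le_mul_right _ (by omega)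
  have hB : LayoutSearch.base I.n I.ℓ I.word ≤ 5 * k := by
    unfold LayoutSearch.base
    omega
  have hB0 : 0 < LayoutSearch.base I.n I.ℓ I.word := by
    unfold LayoutSearch.base
    omega
  have hN : LayoutSearch.guesses I.n I.ℓ I.word ≤ (5 * k) ^ (4 * k) :=
    (Nat.pow_le_pow_left hB _).trans (Nat.pow_le_pow_right (by omega) (by omega))
  set M := A * I.size ^ 2
  have hreg : LayoutSearch.RegsLE M (RamState.init I.encode) := by
    intro r _
    simp only [RamState.init, I.length_encode]
    split <;> omega
  obtain ⟨hl, hQ⟩ := LayoutSearch.ensures_searchCmd (M := M) (s := RamState.init I.encode) hreg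
    (by omega) (by omega) (by omega) hB0 (by omega) (by simp [RamState.init]; rfl) I.word_zero
    I.word_one (by funext; simp [RamState.init]) (by funext; simp [RamState.init])
  obtain ⟨s, t, hr, ht, hs, -⟩ := hw M 19 _ LayoutSearch.searchCmd_below hl _ 19 le_rfl
    ⟨fun _ _ => rfl, rfl⟩
  refine ⟨s, t, hr, ht.trans ?_, ?_⟩
  · rw [pow_mul, ← mul_pow]
    refine Nat.pow_le_pow_left ?_ w
    -- As the square of the size is at least 1, `M + 2` is at most `(A + 2) * I.size ^ 2`.
    have : guessBound k = A + 2 := rfl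
    rw [this, add_mul]
    omega
  · rw [← hs.1 0 (by decide), hQ, I.isYes_iff]
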